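/- **Setting.** Let $m,N\ge 1$, $0<p<2/N$, and let $\alpha_j,\beta_j,\gamma_{ij}=\gamma_{ji},\omega_{ij}=\omega_{ji}\ge 0$ ($i,j=1,\dots,m$). For $u:\mathbb R^N\to\mathbb C^m$ put $|u|_j^{2p}=\alpha_j|u_j|^{2p}+\sum_{i\ne j}\gamma_{ij}|u_i|^{p+1}|u_j|^{p-1}$, $|u|_j^2=\beta_j|u_j|^2+\sum_{i\neq j}\omega_{ij}|u_i|^2$ and $$\mathcal E(u)=\tfrac12\int|\nabla u|^2-\sum_j\tfrac{\alpha_j}{p+1}\int|u_j|^{2p+2}-\sum_{i\ne j}\tfrac{\gamma_{ij}}{p+1}\int|u_i|^{p+1}|u_j|^{p+1}.$$ Let $V,\Phi\in C^3(\mathbb R^N;\mathbb R)$ and $A\in C^3(\mathbb R^N;\mathbb R^N)$ have finite $C^3$ norms, where $\|f\|_{C^k}=\sum_{|a|\le k}\|D^af\|_\infty$, with $V>0$ and $\Phi\ge0$; if $m>1$ suppose moreover that $\Phi\le\Phi(0)$ (for instance $\Phi=0$). For $\varepsilon>0$ let $H_{A,\varepsilon}$ be the closure of $C_c^\infty(\mathbb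 R^N;\mathbb C^m)$, among functions of finite mass $\|u\|_{L^2}^2$, for the norm $\|u\|_{H_{A,\varepsilon}}^2=\int|i^{-1}\nabla u-A(\varepsilon x)u|^2+\int V(\varepsilon x)|u|^2$, and consider $$-i\partial_t\phi_j+\tfrac12\big(i^{-1}\nabla-A(\varepsilon x)\big)^2\phi_j+V(\varepsilon x)\phi_j=|\phi|_j^{2p}\phi_j+\big(\Phi(\varepsilon\,\cdot)*|\phi|_j^2\big)\phi_j,\qquad j=1,\dots,m. \tag{P}$$ Let $r=(r_1,\dots,r_m)\in H^1(\mathbb R^N;\mathbb R^m)$ be a ground state (a nontrivial weak solution with least value of $\mathcal E(u)+\|u\|_{L^2}^2$) of $-\frac12\Delta r_j+r_j=|r|_j^{2p}r_j$, and let $M=\|r\|_{L^2}^2$. Assume that $(V,A,\Phi,r)$ is admissible, that is: * every $r_j$ is radially symmetric and $x_ir_j\in L^2$ for all $i,j$; * (well-posedness) for all $\varepsilon>0$ and $\phi_0\in H_{A,\varepsilon}$, problem (P) with $\phi(0)=\phi_0$ has a unique global solution $\phi\in C([0,\infty),H_{A,\varepsilon})\cap C^1([0,\infty),H_{A,\varepsilon}')$;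 it is bounded in $H_{A,\varepsilon}$, it conserves the masses $\int|\phi_j|^2$ and the energy $\frac12\int|i^{-1}\nabla\phi-A(\varepsilon x)\phi|^2+\int V(\varepsilon x)|\phi|^2-\frac1{p+1}\sum_j\alpha_j\int|\phi_j|^{2p+2}-\frac1{p+1}\sum_{i\ne j}\gamma_{ij}\int|\phi_i|^{p+1}|\phi_j|^{p+1}-\frac12\sum_j\beta_j\iint\Phi(\varepsilon(x-y))|\phi_j(x)|^2|\phi_j(y)|^2-\frac12\sum_{i\neq j}\omega_{ij}\iint\Phi(\varepsilon(x-y))|\phi_i(x)|^2|\phi_j(y)|^2$; and if $\phi_0$ and $(i^{-1}\nabla-A(\varepsilon x))^2\phi_0$ are in $L^2$, then $\phi$ and $(i^{-1}\nabla-A(\varepsilon x))^2\phi$ are in $C([0,\infty),L^2)$ and $\phi\in C^1([0,\infty),L^2)$; * (energy convexity) there are $c,c'>0$ such that $\Gamma_U\le c\,(\mathcal E(U)-\mathcal E(r))$ for every $U\in H^1(\mathbb R^N;\mathbb C^m)$ with $\|U\|_{L^2}=\|r\|_{L^2}$ and $\Gamma_U<c'$, where $\Gamma_U=\inf\big\{\sum_j\|U_j-e^{i\theta_j}r_j(\cdot+y)\|_{H^1}^2: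 y\in\mathbb R^N,\ \theta_1,\dots,\theta_m\in[0,2\pi)\big\}$. Let $x_0,\xi_0\in\mathbb R^N$ and, for $\varepsilon>0$, let $(x_\varepsilon,\xi_\varepsilon)$ be the global solution of $\dot x_\varepsilon=\xi_\varepsilon$, $\dot\xi_\varepsilon=-\varepsilon\nabla V(\varepsilon x_\varepsilon)-\varepsilon\,\xi_\varepsilon\times B(\varepsilon x_\varepsilon)$, $x_\varepsilon(0)=x_0/\varepsilon$, $\xi_\varepsilon(0)=\xi_0$, where $(\xi\times B)_\ell=\sum_i\xi_i(\partial_iA_\ell-\partial_\ell A_i)$. Let $\phi_\varepsilon$ be the solution of (P) with initial datum $\phi_\varepsilon^j(x,0)=r_j(x-x_\varepsilon(0))\,e^{i[A(\varepsilon x_\varepsilon(0))\cdot(x-x_\varepsilon(0))+x\cdot\xi_\varepsilon(0)]}$. Put $$\psi^j_\varepsilon(x,t)=e^{-i\xi_\varepsilon(t)\cdot(x+x_\varepsilon(t))}e^{-iA(\varepsilon x_\varepsilon(t))\cdot x}\phi^j_\varepsilon(x+x_\varepsilon(t),t),\qquad q_\varepsilon=\sum_j\operatorname{Im}\big(\bar\phi^j_\varepsilon(\nabla\phi^j_\varepsilon-iA(\varepsilon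 x)\phi^j_\varepsilon)\big),$$ $$\begin{aligned}\Omega_\varepsilon(t)={}&\Big|\int q_\varepsilon\,dx-M\xi_\varepsilon\Big|+\sup_{\|\varphi\|_{C^3}\le1}\Big|\int\varphi(\varepsilon x)|\phi_\varepsilon|^2dx-M\varphi(\varepsilon x_\varepsilon)\Big|\\&+\Big|M\varepsilon x_\varepsilon-\int\varepsilon x\,\chi(\varepsilon x)|\phi_\varepsilon|^2dx\Big|+\Big|\int A(\varepsilon x)\cdot q_\varepsilon\,dx-MA(\varepsilon x_\varepsilon)\cdot\xi_\varepsilon\Big|,\end{aligned}$$ where $\chi\in C^\infty(\mathbb R^N)$ is a cutoff with $0\le\chi\le1$, $\chi=1$ on $B(0,\tilde\rho)$ and $\chi=0$ outside $B(0,2\tilde\rho)$, for some $\tilde\rho>0$. Fix $T_0>0$ and $0<\sigma_0<c'$ and let $$T^*_\varepsilon=\sup\{t\in[0,T_0/\varepsilon]:\ \Omega_\varepsilon(s)\le\sigma_0\text{ and }\Gamma_{\psi_\varepsilon(s)}\le\sigma_0\text{ for all }s\in(0,t)\}.$$ **Theorem.** There exist $\varepsilon_0>0$, $C>0$ and, for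 $\varepsilon\in(0,\varepsilon_0)$, locally bounded functions $\theta^1_\varepsilon,\dots,\theta^m_\varepsilon:[0,\infty)\to[0,2\pi)$ and $y_\varepsilon:[0,\infty)\to\mathbb R^N$ such that, for all $\varepsilon\in(0,\varepsilon_0)$, $t\in[0,T^*_\varepsilon)$ and $j=1,\dots,m$, $$\phi^j_\varepsilon(x,t)=e^{i(\xi_\varepsilon(t)\cdot x+\theta^j_\varepsilon(t)+A(\varepsilon x_\varepsilon(t))\cdot(x-x_\varepsilon(t)))}\,r_j(x-y_\varepsilon(t))+\omega^j_\varepsilon(x,t),$$ where $\omega^j_\varepsilon(t)\in H^1(\mathbb R^N;\mathbb C)$ and $\|\omega^j_\varepsilon(t)\|_{H^1}\le C\sqrt{\Omega_\varepsilon(t)}+C\varepsilon$. -/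

import Mathlib

noncomputable section

namespace SolitonDynamics

open MeasureTheory Filter Topology Set
open scoped ContDiff ComplexConjugate

/-! ### Sobolev functions through weak gradients -/

/-- Euclidean space `ℝ^N`. -/
abbrev Space (N : ℕ) := EuclideanSpace ℝ (Fin N)

/-- The `k`-th vector of the standard basis of `ℝ^N`. -/
abbrev stdVec {N : ℕ} (k : Fin N) : Space N := EuclideanSpace.single k 1

/-- `C_c^∞` functions on `ℝ^N`. -/
def IsTest {N : ℕ} {F : Type*} [NormedAddCommGroup F] [NormedSpace ℝ F]
    (η : Space N → F) : Prop :=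
  ContDiff ℝ ∞ η ∧ HasCompactSupport η

/-- `g` is the weak (distributional) gradient of `u`. -/
structure HasWeakGrad {N : ℕ} (u : Space N → ℂ) (g : Space N → EuclideanSpace ℂ (Fin N)) :
    Prop where
  locInt : LocallyIntegrable u volume
  locInt_grad : LocallyIntegrable g volume
  integral_eq : ∀ η : Space N → ℝ, IsTest η → ∀ k : Fin N,
    ∫ x, u x * ((fderiv ℝ η x (stdVec k) : ℝ) : ℂ) = -∫ x, g x k * ((η x : ℝ) : ℂ)

open Classical in
/-- The weak gradient of `u`, unique up to null sets (and `0` if there is none). -/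
def weakGrad {N : ℕ} (u : Space N → ℂ) : Space N → EuclideanSpace ℂ (Fin N) :=
  if h : ∃ g, HasWeakGrad u g then h.choose else 0

/-- `u ∈ H^1(ℝ^N; ℂ)`. -/
def MemH1 {N : ℕ} (u : Space N → ℂ) : Prop :=
  MemLp u 2 volume ∧ ∃ g, HasWeakGrad u g ∧ MemLp g 2 volume

/-- `‖u‖_{H^1}^2 = ‖∇u‖_{L^2}^2 + ‖u‖_{L^2}^2`. -/
def h1NormSq {N : ℕ} (u : Space N → ℂ) : ℝ :=
  (∫ x, ‖weakGrad u x‖ ^ 2) + ∫ x, ‖u x‖ ^ 2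

/-- `‖u‖_{H^1}`. -/
def h1Norm {N : ℕ} (u : Space N → ℂ) : ℝ := Real.sqrt (h1NormSq u)

/-- `‖f‖_{C^k} = ∑_{|α| ≤ k} ‖D^α f‖_∞`, with values in `[0, ∞]`. The multi-indices `α` with
`|α| = n` are listed as the nondecreasing `n`-tuples `s` of coordinate indices, and
`D^α f = ∂_{s 0} ⋯ ∂_{s (n-1)} f`. -/
def ckNorm {N : ℕ} {F : Type*} [NormedAddCommGroup F] [NormedSpace ℝ F]
    (k : ℕ) (f : Space N → F) : ENNReal :=
  ∑ n ∈ Finset.range (k + 1), ∑ s : {s : Fin n → Fin N // Monotone s},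
    ⨆ x, ‖iteratedFDeriv ℝ n f x (fun i => stdVec (s.1 i))‖ₑ

/-! ### The Schrödinger system -/

/-- The exponent `p` and the coupling constants `α_j, β_j, γ_{ij}, ω_{ij}` (the last one is
written `w`) of the nonlinearity. -/
structure Couplings (m : ℕ) where
  p : ℝ
  α : Fin m → ℝ
  β : Fin m → ℝ
  γ : Fin m → Fin m → ℝ
  w : Fin m → Fin m → ℝ
  α_nonneg : ∀ j, 0 ≤ α j
  β_nonneg : ∀ j, 0 ≤ β j
  γ_nonneg : ∀ i j, 0 ≤ γ i j
  w_nonneg : ∀ i j, 0 ≤ w i j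
  γ_symm : ∀ i j, γ i j = γ j i
  w_symm : ∀ i j, w i j = w j i

/-- The electric potential `V`, the magnetic potential `A` and the nonlocal potential `Φ`. -/
structure Potentials (N : ℕ) where
  V : Space N → ℝ
  A : Space N → Space N
  Φ : Space N → ℝ

/-- The conditions (V), (A), (Φ) on the potentials. The potential `Φ` may vanish. -/
structure Potentials.Regular {N : ℕ} (P : Potentials N) : Prop where
  V_contDiff : ContDiff ℝ 3 P.V
  V_bdd : ckNorm 3 P.V < ⊤
  V_pos : ∀ x, 0 < P.V x
  A_contDiff : ContDiff ℝ 3 P.A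
  A_bdd : ckNorm 3 P.A < ⊤
  Φ_contDiff : ContDiff ℝ 3 P.Φ
  Φ_bdd : ckNorm 3 P.Φ < ⊤
  Φ_nonneg : ∀ x, 0 ≤ P.Φ x

variable {m N : ℕ}

/-- `|u|_j^{2p} = α_j |u_j|^{2p} + ∑_{i ≠ j} γ_{ij} |u_i|^{p+1} |u_j|^{p-1}`. -/
def locPot (K : Couplings m) (u : Fin m → Space N → ℂ) (j : Fin m) (x : Space N) : ℝ :=
  K.α j * ‖u j x‖ ^ (2 * K.p) +
    ∑ i ∈ Finset.univ.erase j, K.γ i j * ‖u i x‖ ^ (K.p + 1) * ‖u j x‖ ^ (K.p - 1)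

/-- `|u|_j^2 = β_j |u_j|^2 + ∑_{i ≠ j} ω_{ij} |u_i|^2`. -/
def nonlocDensity (K : Couplings m) (u : Fin m → Space N → ℂ) (j : Fin m) (x : Space N) : ℝ :=
  K.β j * ‖u j x‖ ^ 2 + ∑ i ∈ Finset.univ.erase j, K.w i j * ‖u i x‖ ^ 2

/-- The convolution `(Φ(ε ·) * |u|_j^2)(x)`. -/
def nonlocPot (K : Couplings m) (P : Potentials N) (ε : ℝ) (u : Fin m → Space N → ℂ)
    (j : Fin m) (x : Space N) : ℝ :=
  ∫ y, P.Φ (ε • (x - y)) * nonlocDensity K u j y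

/-- The magnetic gradient `Du = i⁻¹ ∇u - A(ε x) u`. -/
def magGrad (A : Space N → Space N) (ε : ℝ) (u : Space N → ℂ) (x : Space N) :
    EuclideanSpace ℂ (Fin N) :=
  WithLp.toLp 2 fun k => -Complex.I * weakGrad u x k - ((A (ε • x) k : ℝ) : ℂ) * u x

/-- `‖u‖_{H_{A,ε}}^2 = ∫ |i⁻¹ ∇u - A(ε x) u|^2 + ∫ V(ε x) |u|^2`. -/
def normSqHA (P : Potentials N) (ε : ℝ) (u : Fin m → Space N → ℂ) : ℝ :=
  ∑ j, ((∫ x, ‖magGrad P.A ε (u j) x‖ ^ 2) + ∫ x, P.V (ε • x) * ‖u j x‖ ^ 2)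

/-- `u ∈ H_{A,ε}`: the closure of `C_c^∞(ℝ^N; ℂ^m)` for the norm `‖·‖_{H_{A,ε}}`, among the
functions of finite mass. -/
def MemHA (P : Potentials N) (ε : ℝ) (u : Fin m → Space N → ℂ) : Prop :=
  (∀ j, MemLp (u j) 2 volume ∧ (∃ g, HasWeakGrad (u j) g) ∧
    MemLp (magGrad P.A ε (u j)) 2 volume ∧ Integrable (fun x => P.V (ε • x) * ‖u j x‖ ^ 2)) ∧
  ∀ η : ℝ, 0 < η → ∃ v : Fin m → Space N → ℂ, (∀ j, IsTest (v j)) ∧ normSqHA P ε (u - v) < η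

/-- The `L^2` pairing `∑_j ∫ u_j \bar v_j`. -/
def pairing (u v : Fin m → Space N → ℂ) : ℂ :=
  ∑ j, ∫ x, u j x * conj (v j x)

/-- The functional `v ↦ ⟨L_A u + V(ε x) u - |u|^{2p} u - (Φ(ε ·) * |u|^2) u, v⟩` in the dual of
`H_{A,ε}`, where `L_A = ½ (i⁻¹ ∇ - A(ε x))^2` acts through its quadratic form. -/
def weakField (K : Couplings m) (P : Potentials N) (ε : ℝ) (u v : Fin m → Space N → ℂ) : ℂ :=
  ∑ j, ∫ x,
    ((1 / 2 : ℂ) * ∑ k, magGrad P.A ε (u j) x k * conj (magGrad P.A ε (v j) x k) +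
      ((P.V (ε • x) - locPot K u j x - nonlocPot K P ε u j x : ℝ) : ℂ)
        * (u j x * conj (v j x)))

/-- `φ ∈ C([0,∞), H_{A,ε}) ∩ C^1([0,∞), H_{A,ε}')` solves the Cauchy problem
`-i ∂_t φ_j + L_A φ_j + V(ε x) φ_j = |φ|_j^{2p} φ_j + (Φ(ε ·) * |φ|_j^2) φ_j`, `φ(0) = φ₀`.
Elements of the dual of `H_{A,ε}` are given by their values on the dense set of test functions;
`hasDeriv` says that `i ∂_t φ(t)` exists in the norm of the dual and equals the functional
`weakField`, and `deriv_cont` that it depends continuously on `t` in that norm. -/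
structure IsSolution (K : Couplings m) (P : Potentials N) (ε : ℝ)
    (φ₀ : Fin m → Space N → ℂ) (φ : ℝ → Fin m → Space N → ℂ) : Prop where
  mem : ∀ t, 0 ≤ t → MemHA P ε (φ t)
  cont : ∀ t, 0 ≤ t → Tendsto (fun s => normSqHA P ε (φ s - φ t)) (𝓝[Ici 0] t) (𝓝 0)
  hasDeriv : ∀ t, 0 ≤ t → ∀ η : ℝ, 0 < η → ∀ᶠ s in 𝓝[Ici 0] t,
    ∀ v : Fin m → Space N → ℂ, (∀ j, IsTest (v j)) →
      ‖Complex.I * pairing (φ s - φ t) v - ((s - t : ℝ) : ℂ) * weakField K P ε (φ t) v‖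
        ≤ η * |s - t| * Real.sqrt (normSqHA P ε v)
  deriv_cont : ∀ t, 0 ≤ t → ∀ η : ℝ, 0 < η → ∀ᶠ s in 𝓝[Ici 0] t,
    ∀ v : Fin m → Space N → ℂ, (∀ j, IsTest (v j)) →
      ‖weakField K P ε (φ s) v - weakField K P ε (φ t) v‖ ≤ η * Real.sqrt (normSqHA P ε v)
  init : ∀ j, φ 0 j =ᵐ[volume] φ₀ j

/-- The `j`-th mass `∫ |u_j|^2`. -/
def mass (u : Fin m → Space N → ℂ) (j : Fin m) : ℝ := ∫ x, ‖u j x‖ ^ 2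

/-- The total energy `E_ε`. -/
def totalEnergy (K : Couplings m) (P : Potentials N) (ε : ℝ) (u : Fin m → Space N → ℂ) : ℝ :=
  (1 / 2) * ∑ j, (∫ x, ‖magGrad P.A ε (u j) x‖ ^ 2)
  + ∑ j, (∫ x, P.V (ε • x) * ‖u j x‖ ^ 2)
  - 1 / (K.p + 1) * ∑ j, K.α j * (∫ x, ‖u j x‖ ^ (2 * K.p + 2))
  - 1 / (K.p + 1) * ∑ j, ∑ i ∈ Finset.univ.erase j,
      K.γ i j * (∫ x, ‖u i x‖ ^ (K.p + 1) * ‖u j x‖ ^ (K.p + 1))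
  - (1 / 2) * ∑ j, K.β j * (∫ x, ∫ y, P.Φ (ε • (x - y)) * ‖u j x‖ ^ 2 * ‖u j y‖ ^ 2)
  - (1 / 2) * ∑ j, ∑ i ∈ Finset.univ.erase j,
      K.w i j * (∫ x, ∫ y, P.Φ (ε • (x - y)) * ‖u i x‖ ^ 2 * ‖u j y‖ ^ 2)

/-- The `k`-th classical magnetic derivative `D_k v = i⁻¹ ∂_k v - A_k(ε x) v`. -/
def magDeriv (A : Space N → Space N) (ε : ℝ) (k : Fin N) (v : Space N → ℂ) (x : Space N) : ℂ :=
  -Complex.I * fderiv ℝ v x (stdVec k) - ((A (ε • x) k : ℝ) : ℂ) * v x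

/-- `f = (i⁻¹ ∇ - A(ε x))^2 u` in the sense of distributions. -/
structure HasMagSq (A : Space N → Space N) (ε : ℝ) (u f : Space N → ℂ) : Prop where
  locInt : LocallyIntegrable u volume
  locInt_sq : LocallyIntegrable f volume
  integral_eq : ∀ v : Space N → ℂ, IsTest v →
    ∫ x, u x * conj (∑ k, magDeriv A ε k (magDeriv A ε k v) x) = ∫ x, f x * conj (v x)

open Classical in
/-- `(i⁻¹ ∇ - A(ε x))^2 u`. -/
def magSq (A : Space N → Space N) (ε : ℝ) (u : Space N → ℂ) : Space N → ℂ :=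
  if h : ∃ f, HasMagSq A ε u f then h.choose else 0

/-- `u ∈ H_{A,ε}^2`. -/
def MemHA2 (P : Potentials N) (ε : ℝ) (u : Fin m → Space N → ℂ) : Prop :=
  ∀ j, MemLp (u j) 2 volume ∧ ∃ f, HasMagSq P.A ε (u j) f ∧ MemLp f 2 volume

/-- `‖u‖_{H_{A,ε}^2}^2`. -/
def normSqHA2 (P : Potentials N) (ε : ℝ) (u : Fin m → Space N → ℂ) : ℝ :=
  ∑ j, ((∫ x, ‖u j x‖ ^ 2) + ∫ x, ‖magSq P.A ε (u j) x‖ ^ 2)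

/-- `φ ∈ C^1([0,∞), L^2(ℝ^N; ℂ^m))`. -/
def IsC1L2 (φ : ℝ → Fin m → Space N → ℂ) : Prop :=
  (∀ t, 0 ≤ t → ∀ j, MemLp (φ t j) 2 volume) ∧
  ∃ φ' : ℝ → Fin m → Space N → ℂ, ∀ t, 0 ≤ t → ∀ j, MemLp (φ' t j) 2 volume ∧
    Tendsto (fun s => ∫ x, ‖((s - t)⁻¹ : ℝ) • (φ s j x - φ t j x) - φ' t j x‖ ^ 2)
      (𝓝[Ici 0 \ {t}] t) (𝓝 0) ∧
    Tendsto (fun s => ∫ x, ‖φ' s j x - φ' t j x‖ ^ 2) (𝓝[Ici 0] t) (𝓝 0)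

/-- Global well-posedness in `H_{A,ε}` for every `ε > 0`, with bounded solutions, conservation of
the masses and of the total energy, and propagation of `H_{A,ε}^2` regularity. -/
def WellPosed (K : Couplings m) (P : Potentials N) : Prop :=
  ∀ ε : ℝ, 0 < ε → ∀ φ₀ : Fin m → Space N → ℂ, MemHA P ε φ₀ →
    (∃ φ, IsSolution K P ε φ₀ φ) ∧
    (∀ φ φ', IsSolution K P ε φ₀ φ → IsSolution K P ε φ₀ φ' →
      ∀ t, 0 ≤ t → ∀ j, φ t j =ᵐ[volume] φ' t j) ∧
    ∀ φ, IsSolution K P ε φ₀ φ →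
      (∃ B : ℝ, ∀ t, 0 ≤ t → normSqHA P ε (φ t) ≤ B) ∧
      (∀ t, 0 ≤ t → ∀ j, mass (φ t) j = mass (φ 0) j) ∧
      (∀ t, 0 ≤ t → totalEnergy K P ε (φ t) = totalEnergy K P ε (φ 0)) ∧
      (MemHA2 P ε φ₀ →
        (∀ t, 0 ≤ t → MemHA2 P ε (φ t)) ∧
        (∀ t, 0 ≤ t → Tendsto (fun s => normSqHA2 P ε (φ s - φ t)) (𝓝[Ici 0] t) (𝓝 0)) ∧
        IsC1L2 φ)

/-! ### Ground states -/

/-- A real-valued vector function, seen as a complex-valued one. -/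
def cplx (r : Fin m → Space N → ℝ) : Fin m → Space N → ℂ := fun j x => (r j x : ℂ)

/-- The functional `𝓔`. -/
def energy (K : Couplings m) (u : Fin m → Space N → ℂ) : ℝ :=
  (1 / 2) * ∑ j, (∫ x, ‖weakGrad (u j) x‖ ^ 2)
  - ∑ j, K.α j / (K.p + 1) * (∫ x, ‖u j x‖ ^ (2 * K.p + 2))
  - ∑ j, ∑ i ∈ Finset.univ.erase j,
      K.γ i j / (K.p + 1) * (∫ x, ‖u i x‖ ^ (K.p + 1) * ‖u j x‖ ^ (K.p + 1))

/-- The total mass `M = ∑_j ‖u_j‖_{L^2}^2`. -/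
def totalMass (u : Fin m → Space N → ℂ) : ℝ := ∑ j, mass u j

/-- `u ∈ H^1(ℝ^N; ℝ^m)` is a nontrivial weak solution of `-½ Δu_j + u_j = |u|_j^{2p} u_j`. -/
structure IsStationary (K : Couplings m) (u : Fin m → Space N → ℝ) : Prop where
  memH1 : ∀ j, MemH1 (cplx u j)
  ne_zero : ∃ j, ¬ u j =ᵐ[volume] 0
  weak_eq : ∀ j, ∀ η : Space N → ℝ, IsTest η →
    (1 / 2 : ℂ) * ∑ k, (∫ x, weakGrad (cplx u j) x k * ((fderiv ℝ η x (stdVec k) : ℝ) : ℂ))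
      + ∫ x, ((u j x * η x : ℝ) : ℂ)
    = ∫ x, ((locPot K (cplx u) j x * u j x * η x : ℝ) : ℂ)

/-- A real ground state: a nontrivial solution of least action, the action of `u` being
`½ (𝓔(u) + ‖u‖_{L^2}^2)`. -/
structure IsGroundState (K : Couplings m) (r : Fin m → Space N → ℝ) : Prop where
  stationary : IsStationary K r
  least : ∀ u : Fin m → Space N → ℝ, IsStationary K u →
    energy K (cplx r) + totalMass (cplx r) ≤ energy K (cplx u) + totalMass (cplx u)

/-- `Γ_U`: the infimum over `y ∈ ℝ^N` and `θ_1, …, θ_m ∈ [0, 2π)` of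
`‖U - (e^{iθ_1} r_1(· + y), …, e^{iθ_m} r_m(· + y))‖_{H^1}^2`. -/
def orbitDistSq (r : Fin m → Space N → ℝ) (U : Fin m → Space N → ℂ) : ℝ :=
  sInf {d : ℝ | ∃ (y : Space N) (θ : Fin m → ℝ), (∀ j, θ j ∈ Ico 0 (2 * Real.pi)) ∧
    d = ∑ j, h1NormSq fun x => U j x - Complex.exp (Complex.I * (θ j : ℂ)) * (r j (x + y) : ℂ)}

/-- The energy convexity inequality, with constants `c` and `c'`. -/
def EnergyConvexity (K : Couplings m) (r : Fin m → Space N → ℝ) (c c' : ℝ) : Prop :=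
  ∀ U : Fin m → Space N → ℂ, (∀ j, MemH1 (U j)) → totalMass U = totalMass (cplx r) →
    orbitDistSq r U < c' → orbitDistSq r U ≤ c * (energy K U - energy K (cplx r))

/-- `(V, A, Φ, r)` is an admissible string, with constants `c, c'` in the energy convexity
inequality. -/
structure Admissible (K : Couplings m) (P : Potentials N) (r : Fin m → Space N → ℝ)
    (c c' : ℝ) : Prop where
  radial : ∀ j x y, ‖x‖ = ‖y‖ → r j x = r j y
  moment : ∀ j, ∀ i : Fin N, MemLp (fun x : Space N => x i * r j x) 2 volume
  wellPosed : WellPosed K P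
  c_pos : 0 < c
  c'_pos : 0 < c'
  convexity : EnergyConvexity K r c c'

/-! ### The trajectory, the initial datum, and the quantities `ψ_ε`, `Ω_ε`, `T_ε^*` -/

/-- `v × B(z)`, for the magnetic field `B = ∇ × A` seen as the 2-form with coefficients
`B_{iℓ} = ∂_i A_ℓ - ∂_ℓ A_i`: `(v × B)_ℓ = ∑_i v_i B_{iℓ}`. -/
def crossB (A : Space N → Space N) (v z : Space N) : Space N :=
  WithLp.toLp 2 fun l => ∑ i, v i * (fderiv ℝ A z (stdVec i) l - fderiv ℝ A z (stdVec l) i)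

/-- `(x, ξ)` is the global solution of `ẋ = ξ`, `ξ̇ = -ε ∇V(ε x) - ε ξ × B(ε x)`,
`x(0) = x₀ / ε`, `ξ(0) = ξ₀`. -/
structure IsTrajectory (P : Potentials N) (ε : ℝ) (x₀ ξ₀ : Space N) (x ξ : ℝ → Space N) :
    Prop where
  x_init : x 0 = ε⁻¹ • x₀
  ξ_init : ξ 0 = ξ₀
  x_deriv : ∀ t, 0 ≤ t → HasDerivWithinAt x (ξ t) (Ici 0) t
  ξ_deriv : ∀ t, 0 ≤ t → HasDerivWithinAt ξ
    (-(ε • gradient P.V (ε • x t)) - ε • crossB P.A (ξ t) (ε • x t)) (Ici 0) t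

/-- The initial datum `r_j(x - X) e^{i [A(ε X) · (x - X) + x · Ξ]}`. -/
def initialDatum (A : Space N → Space N) (ε : ℝ) (r : Fin m → Space N → ℝ) (X Ξ : Space N) :
    Fin m → Space N → ℂ :=
  fun j x => (r j (x - X) : ℂ) *
    Complex.exp (Complex.I * ((inner ℝ (A (ε • X)) (x - X) + inner ℝ x Ξ : ℝ) : ℂ))

/-- `ψ_j(x) = e^{-i Ξ · (x + X)} e^{-i A(ε X) · x} u_j(x + X)`. -/
def recentred (A : Space N → Space N) (ε : ℝ) (u : Fin m → Space N → ℂ) (X Ξ : Space N) :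
    Fin m → Space N → ℂ :=
  fun j x => Complex.exp (-Complex.I * ((inner ℝ Ξ (x + X) : ℝ) : ℂ)) *
    Complex.exp (-Complex.I * ((inner ℝ (A (ε • X)) x : ℝ) : ℂ)) * u j (x + X)

/-- The total magnetic momentum `q^A = ∑_j Im(\bar u_j (∇u_j - i A(ε x) u_j))`. -/
def momentum (A : Space N → Space N) (ε : ℝ) (u : Fin m → Space N → ℂ) (x : Space N) : Space N :=
  WithLp.toLp 2 fun k => ∑ j,
    (conj (u j x) * (weakGrad (u j) x k - Complex.I * ((A (ε • x) k : ℝ) : ℂ) * u j x)).im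

/-- The density `|u|^2 = ∑_j |u_j|^2`. -/
def density (u : Fin m → Space N → ℂ) (x : Space N) : ℝ := ∑ j, ‖u j x‖ ^ 2

/-- A smooth cutoff: `0 ≤ χ ≤ 1`, `χ = 1` in `B(0, ρ)`, `χ = 0` outside `B(0, 2ρ)`. -/
structure IsCutoff (ρ : ℝ) (χ : Space N → ℝ) : Prop where
  smooth : ContDiff ℝ ∞ χ
  nonneg : ∀ x, 0 ≤ χ x
  le_one : ∀ x, χ x ≤ 1
  eq_one : ∀ x ∈ Metric.ball (0 : Space N) ρ, χ x = 1
  eq_zero : ∀ x ∉ Metric.ball (0 : Space N) (2 * ρ), χ x = 0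

/-- The functional `φ ↦ ∫ Π² φ = ∫ φ(ε x) |u|^2 - M φ(ε X)`. -/
def densityDefect (ε M : ℝ) (u : Fin m → Space N → ℂ) (X : Space N) (φ : Space N → ℝ) : ℝ :=
  (∫ x, φ (ε • x) * density u x) - M * φ (ε • X)

/-- `|∫ Π¹| + sup_{‖φ‖_{C³} ≤ 1} |∫ Π² φ| + |γ|`, with
`∫ Π¹ = ∫ q^A - M Ξ` and `γ = M ε X - ∫ ε x χ(ε x) |u|^2`. -/
def omegaHat (A : Space N → Space N) (χ : Space N → ℝ) (ε M : ℝ) (u : Fin m → Space N → ℂ)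
    (X Ξ : Space N) : ℝ :=
  ‖(∫ x, momentum A ε u x) - M • Ξ‖
  + sSup {d : ℝ | ∃ φ : Space N → ℝ, ContDiff ℝ 3 φ ∧ ckNorm 3 φ ≤ 1 ∧
      d = |densityDefect ε M u X φ|}
  + ‖M • (ε • X) - ∫ x, (χ (ε • x) * density u x) • (ε • x)‖

/-- `ρ^A = |∫ Π¹ · A| = |∫ A(ε x) · q^A - M A(ε X) · Ξ|`. -/
def rhoA (A : Space N → Space N) (ε M : ℝ) (u : Fin m → Space N → ℂ) (X Ξ : Space N) : ℝ :=
  |(∫ x, inner ℝ (A (ε • x)) (momentum A ε u x)) - M * inner ℝ (A (ε • X)) Ξ|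

/-- `Ω = Ω̂ + ρ^A`. -/
def omega (A : Space N → Space N) (χ : Space N → ℝ) (ε M : ℝ) (u : Fin m → Space N → ℂ)
    (X Ξ : Space N) : ℝ :=
  omegaHat A χ ε M u X Ξ + rhoA A ε M u X Ξ

/-- `sup {t ∈ [0, T] : Ω(s), Γ(s) ≤ σ for all s ∈ (0, t)}`. -/
def exitTime (T σ : ℝ) (Ω Γ : ℝ → ℝ) : ℝ :=
  sSup {t : ℝ | t ∈ Icc 0 T ∧ ∀ s ∈ Ioo 0 t, Ω s ≤ σ ∧ Γ s ≤ σ}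

/-- `f : [0, ∞) → F` is locally bounded. -/
def LocBdd {F : Type*} [Norm F] (f : ℝ → F) : Prop :=
  ∀ T : ℝ, ∃ B : ℝ, ∀ t ∈ Icc 0 T, ‖f t‖ ≤ B

end SolitonDynamics

end

noncomputable section

namespace SolitonDynamics

open MeasureTheory Filter Topology Set
open scoped ContDiff ComplexConjugate

variable {m N : ℕ}

/-! ### Calculus of weak gradients -/

/-! The proof compares the energy of the recentred solution `ψ` with that of the ground state and
then applies energy convexity. Put `b = ξ + A(εX)`, with `X` the classical position. Undoing the
phase and the translation completes a square in the kinetic term (`normSq_sub_smul_imVec`), while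
the local nonlinearities see only `|φ|`. Hence (`energy_recentred`) `𝓔(ψ)` is the total energy minus
`∫ V(εx)|φ|²`, plus the nonlocal energy, plus `½ ∫ |b - A(εx)|² |φ|²`, minus `∫ (b - A(εx)) · q`.

At time `t`, `Ω` measures how far density and momentum are from point masses carried by the
trajectory. Up to `O(Ω)`, `𝓔(ψ)` is therefore at most the total energy minus `M(½|ξ|² + V(εX))` plus
a multiple of `Φ(0)` depending only on the component masses (`exists_energy_recentred_le`). At time
`0`, `ψ` is `r` itself; `r_j²` is even with finite second moment, so first order Taylor terms
integrate to zero and the matching lower bound holds up to `O(ε²)`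
(`exists_le_energy_initialDatum`). Total energy, component masses and the classical Hamiltonian are
conserved, so the main terms cancel and `𝓔(ψ(t)) - 𝓔(r) ≤ C(Ω + ε²)` (`exists_energy_sub_le`).

Before the exit time `Γ ≤ σ₀ < c'`, so convexity bounds `Γ` by a multiple of `Ω + ε²`. Nearly
optimal phases and shifts give the profile. Returning to the original frame multiplies the error by
a plane wave of bounded frequency, which costs a constant in `H^1`; a square root finishes.

The shift must also be locally bounded in time (`exists_shift`). For small `Ω`, most of the mass of
`ψ` lies in the ball of radius `1/ε`, which confines the shift (`norm_shift_le`). For `Ω` bounded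
below, the zero shift is good enough. -/

lemma IsTest.integrable_mul {u : Space N → ℂ} (hu : LocallyIntegrable u volume)
    {η : Space N → ℝ} (hη : IsTest η) : Integrable fun x => u x * ((η x : ℝ) : ℂ) := by
  have h := hu.integrable_smul_left_of_hasCompactSupport hη.1.continuous hη.2
  refine h.congr (Eventually.of_forall fun x => ?_)
  simp [mul_comm]

lemma IsTest.fderiv_apply {η : Space N → ℝ} (hη : IsTest η) (v : Space N) :
    IsTest fun x => fderiv ℝ η x v := by
  refine ⟨?_, hη.2.fderiv_apply (𝕜 := ℝ) v⟩
  exact (hη.1.fderiv_right (m := ∞) (by simp)).clm_apply contDiff_const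

lemma IsTest.comp_add {η : Space N → ℝ} (hη : IsTest η) (a : Space N) :
    IsTest fun x => η (x + a) :=
  ⟨hη.1.comp (contDiff_id.add contDiff_const), hη.2.comp_homeomorph (Homeomorph.addRight a)⟩

lemma IsTest.mul_left {η f : Space N → ℝ} (hη : IsTest η) (hf : ContDiff ℝ ∞ f) :
    IsTest fun x => f x * η x :=
  ⟨hf.mul hη.1, hη.2.mul_left⟩

lemma locallyIntegrable_coord {g : Space N → EuclideanSpace ℂ (Fin N)}
    (hg : LocallyIntegrable g volume) (k : Fin N) :
    LocallyIntegrable (fun x => g x k) volume := by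
  refine hg.mono ?_ (Eventually.of_forall fun x => PiLp.norm_apply_le (g x) k)
  exact (EuclideanSpace.proj (𝕜 := ℂ) k).continuous.comp_aestronglyMeasurable
    hg.aestronglyMeasurable

lemma locallyIntegrable_comp_add {F : Type*} [NormedAddCommGroup F] {f : Space N → F}
    (hf : LocallyIntegrable f volume) (a : Space N) :
    LocallyIntegrable (fun x => f (x + a)) volume := by
  have h := (locallyIntegrable_map_homeomorph (Homeomorph.addRight a) (f := f)
    (μ := (volume : Measure (Space N)))).1 (by
      have : Measure.map (Homeomorph.addRight a) (volume : Measure (Space N)) = volume :=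
        map_add_right_eq_self volume a
      rwa [this])
  exact h

/-- Fundamental lemma of the calculus of variations, coordinate by coordinate. It makes `weakGrad`,
which is defined by choice, computable: any explicit weak gradient may replace it under an integral.
-/
lemma HasWeakGrad.ae_unique {u : Space N → ℂ} {g h : Space N → EuclideanSpace ℂ (Fin N)}
    (hg : HasWeakGrad u g) (hh : HasWeakGrad u h) : g =ᵐ[volume] h := by
  have key : ∀ k, ∀ᵐ x, g x k = h x k := fun k => by
    refine ae_eq_of_integral_contDiff_smul_eq (locallyIntegrable_coord hg.locInt_grad k)
      (locallyIntegrable_coord hh.locInt_grad k) fun η h1 h2 => ?_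
    have := (hg.integral_eq η ⟨h1, h2⟩ k).symm.trans (hh.integral_eq η ⟨h1, h2⟩ k)
    simpa [mul_comm] using this
  filter_upwards [ae_all_iff.2 key] with x hx
  ext k
  exact hx k

lemma HasWeakGrad.weakGrad {u : Space N → ℂ} {g : Space N → EuclideanSpace ℂ (Fin N)}
    (hg : HasWeakGrad u g) : HasWeakGrad u (weakGrad u) := by
  have h : ∃ g, HasWeakGrad u g := ⟨g, hg⟩
  rw [SolitonDynamics.weakGrad, dif_pos h]
  exact h.choose_spec

lemma HasWeakGrad.weakGrad_ae_eq {u : Space N → ℂ} {g : Space N → EuclideanSpace ℂ (Fin N)}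
    (hg : HasWeakGrad u g) : SolitonDynamics.weakGrad u =ᵐ[volume] g :=
  hg.weakGrad.ae_unique hg

lemma HasWeakGrad.congr {u v : Space N → ℂ} {g : Space N → EuclideanSpace ℂ (Fin N)}
    (hg : HasWeakGrad u g) (huv : u =ᵐ[volume] v) : HasWeakGrad v g where
  locInt := hg.locInt.mono (hg.locInt.aestronglyMeasurable.congr huv)
    (by filter_upwards [huv] with x hx using by rw [hx])
  locInt_grad := hg.locInt_grad
  integral_eq η hη k := by
    rw [← hg.integral_eq η hη k]
    refine integral_congr_ae ?_
    filter_upwards [huv] with x hx using by rw [hx]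

lemma HasWeakGrad.sub {u v : Space N → ℂ} {g h : Space N → EuclideanSpace ℂ (Fin N)}
    (hg : HasWeakGrad u g) (hh : HasWeakGrad v h) :
    HasWeakGrad (fun x => u x - v x) (fun x => g x - h x) where
  locInt := hg.locInt.sub hh.locInt
  locInt_grad := hg.locInt_grad.sub hh.locInt_grad
  integral_eq η hη k := by
    have e1 := hg.integral_eq η hη k
    have e2 := hh.integral_eq η hη k
    simp only [sub_mul, PiLp.sub_apply]
    rw [integral_sub ((hη.fderiv_apply (stdVec k)).integrable_mul hg.locInt)
        ((hη.fderiv_apply (stdVec k)).integrable_mul hh.locInt),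
      integral_sub (hη.integrable_mul (locallyIntegrable_coord hg.locInt_grad k))
        (hη.integrable_mul (locallyIntegrable_coord hh.locInt_grad k)), e1, e2]
    ring

lemma HasWeakGrad.comp_add {u : Space N → ℂ} {g : Space N → EuclideanSpace ℂ (Fin N)}
    (hg : HasWeakGrad u g) (a : Space N) :
    HasWeakGrad (fun x => u (x + a)) (fun x => g (x + a)) where
  locInt := locallyIntegrable_comp_add hg.locInt a
  locInt_grad := locallyIntegrable_comp_add hg.locInt_grad a
  integral_eq η hη k := by
    have e := hg.integral_eq _ (hη.comp_add (-a)) k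
    rw [← integral_add_right_eq_self _ a, ← integral_add_right_eq_self (fun x => g x k * _) a] at e
    simpa [fderiv_comp_add_right] using e

/-- The plane wave `e^{i (b · x + κ)}`. -/
def planeWave (b : Space N) (κ : ℝ) (x : Space N) : ℂ :=
  Complex.exp (Complex.I * ((inner ℝ b x + κ : ℝ) : ℂ))

lemma planeWave_eq (b : Space N) (κ : ℝ) (x : Space N) :
    planeWave b κ x = ((Real.cos (inner ℝ b x + κ) : ℝ) : ℂ)
      + Complex.I * ((Real.sin (inner ℝ b x + κ) : ℝ) : ℂ) := by
  rw [planeWave, mul_comm, Complex.exp_mul_I, mul_comm Complex.I]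
  simp

@[simp] lemma norm_planeWave (b : Space N) (κ : ℝ) (x : Space N) : ‖planeWave b κ x‖ = 1 := by
  rw [planeWave, mul_comm, Complex.norm_exp_ofReal_mul_I]

lemma continuous_planeWave (b : Space N) (κ : ℝ) : Continuous (planeWave b κ) := by
  unfold planeWave; fun_prop

/-- The complex vector `i b`. -/
def imVec (b : Space N) : EuclideanSpace ℂ (Fin N) :=
  WithLp.toLp 2 fun k => Complex.I * ((b k : ℝ) : ℂ)

@[simp] lemma imVec_apply (b : Space N) (k : Fin N) :
    imVec b k = Complex.I * ((b k : ℝ) : ℂ) := rfl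

@[simp] lemma norm_imVec (b : Space N) : ‖imVec b‖ = ‖b‖ := by
  simp [EuclideanSpace.norm_eq]

lemma HasWeakGrad.planeWave_mul {u : Space N → ℂ} {g : Space N → EuclideanSpace ℂ (Fin N)}
    (hg : HasWeakGrad u g) (b : Space N) (κ : ℝ) :
    HasWeakGrad (fun x => planeWave b κ x * u x)
      (fun x => planeWave b κ x • (g x + u x • imVec b)) := by
  have hwm : AEStronglyMeasurable (planeWave b κ) volume :=
    (continuous_planeWave b κ).aestronglyMeasurable
  have hub : LocallyIntegrable (fun x => u x • imVec b) volume := by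
    refine (hg.locInt.smul ‖b‖).mono
      (hg.locInt.aestronglyMeasurable.smul_const _) (Eventually.of_forall fun x => ?_)
    simp [norm_smul, mul_comm]
  have hG : LocallyIntegrable (fun x => g x + u x • imVec b) volume := hg.locInt_grad.add hub
  refine ⟨?_, ?_, fun η hη k => ?_⟩
  · exact hg.locInt.mono (hwm.mul hg.locInt.aestronglyMeasurable)
      (Eventually.of_forall fun x => by simp)
  · exact hG.mono (hwm.smul hG.aestronglyMeasurable)
      (Eventually.of_forall fun x => by rw [norm_smul, norm_planeWave, one_mul])
  -- Test functions are real, so `e^{iL} η` is not one. The weak identity is used with `cos L · η`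
  -- and `sin L · η` separately, and the results are recombined as real and imaginary parts of the
  -- phase.
  · set L : Space N → ℝ := fun x => inner ℝ b x + κ
    have hLx : ∀ x, L x = inner ℝ b x + κ := fun _ => rfl
    have hLs : ContDiff ℝ ∞ L := (contDiff_const.inner ℝ contDiff_id).add contDiff_const
    have hLd : ∀ x, HasFDerivAt L (innerSL ℝ b) x := fun x =>
      (innerSL ℝ b).hasFDerivAt.add_const κ
    have hc : IsTest fun x => Real.cos (L x) * η x := hη.mul_left hLs.cos
    have hs : IsTest fun x => Real.sin (L x) * η x := hη.mul_left hLs.sin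
    have hηd : ∀ x, HasFDerivAt η (fderiv ℝ η x) x := fun x =>
      (hη.1.differentiable (by simp) x).hasFDerivAt
    have dc : ∀ x, fderiv ℝ (fun x => Real.cos (L x) * η x) x (stdVec k)
        = Real.cos (L x) * fderiv ℝ η x (stdVec k) - η x * (Real.sin (L x) * b k) := fun x => by
      rw [HasFDerivAt.fderiv (f := fun x => Real.cos (L x) * η x) ((hLd x).cos.mul (hηd x))]
      simp [EuclideanSpace.inner_single_right]
      ring
    have ds : ∀ x, fderiv ℝ (fun x => Real.sin (L x) * η x) x (stdVec k)
        = Real.sin (L x) * fderiv ℝ η x (stdVec k) + η x * (Real.cos (L x) * b k) := fun x => by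
      rw [HasFDerivAt.fderiv (f := fun x => Real.sin (L x) * η x) ((hLd x).sin.mul (hηd x))]
      simp [EuclideanSpace.inner_single_right]
    have ec := hg.integral_eq _ hc k
    have es := hg.integral_eq _ hs k
    have ic := (hc.fderiv_apply (stdVec k)).integrable_mul hg.locInt
    have is := (hs.fderiv_apply (stdVec k)).integrable_mul hg.locInt
    have igc := hc.integrable_mul (locallyIntegrable_coord hg.locInt_grad k)
    have igs := hs.integrable_mul (locallyIntegrable_coord hg.locInt_grad k)
    have iuc := hc.integrable_mul hg.locInt
    have ius := hs.integrable_mul hg.locInt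
    have e1 : ∀ x, planeWave b κ x * u x * ((fderiv ℝ η x (stdVec k) : ℝ) : ℂ)
        = (u x * ((fderiv ℝ (fun x => Real.cos (L x) * η x) x (stdVec k) : ℝ) : ℂ)
          + Complex.I * (u x * ((fderiv ℝ (fun x => Real.sin (L x) * η x) x (stdVec k) : ℝ) : ℂ)))
          - (Complex.I * b k) * (u x * ((Real.cos (L x) * η x : ℝ) : ℂ)
            + Complex.I * (u x * ((Real.sin (L x) * η x : ℝ) : ℂ))) := fun x => by
      rw [dc, ds, planeWave_eq, ← hLx x]
      push_cast
      linear_combination (u x * η x * Complex.sin (L x) * b k) * Complex.I_sq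
    have e2 : ∀ x, (planeWave b κ x • (g x + u x • imVec b)) k * ((η x : ℝ) : ℂ)
        = (g x k * ((Real.cos (L x) * η x : ℝ) : ℂ)
          + Complex.I * (g x k * ((Real.sin (L x) * η x : ℝ) : ℂ)))
          + (Complex.I * b k) * (u x * ((Real.cos (L x) * η x : ℝ) : ℂ)
            + Complex.I * (u x * ((Real.sin (L x) * η x : ℝ) : ℂ))) := fun x => by
      rw [planeWave_eq, ← hLx x]
      simp only [PiLp.smul_apply, PiLp.add_apply, imVec_apply, smul_eq_mul]
      push_cast
      ring
    simp_rw [e1, e2]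
    have i1 := ic.add (is.const_mul Complex.I)
    have i2 := igc.add (igs.const_mul Complex.I)
    have i3 := (iuc.add (ius.const_mul Complex.I)).const_mul (Complex.I * b k)
    simp only [Pi.add_def] at i1 i2 i3
    rw [integral_sub i1 i3, integral_add i2 i3,
      integral_add ic (is.const_mul _), integral_add igc (igs.const_mul _),
      integral_const_mul, integral_const_mul, integral_const_mul, ec, es]
    ring

lemma HasWeakGrad.conj {u : Space N → ℂ} {g : Space N → EuclideanSpace ℂ (Fin N)}
    (hg : HasWeakGrad u g) :
    HasWeakGrad (fun x => conj (u x)) (fun x => WithLp.toLp 2 fun k => conj (g x k)) where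
  locInt := hg.locInt.mono
    (Complex.continuous_conj.comp_aestronglyMeasurable hg.locInt.aestronglyMeasurable)
    (Eventually.of_forall fun x => by simp)
  locInt_grad := by
    refine hg.locInt_grad.mono ?_ (Eventually.of_forall fun x => by simp [EuclideanSpace.norm_eq])
    have hc : Continuous fun v : EuclideanSpace ℂ (Fin N) =>
        (WithLp.toLp 2 fun k => conj (v k) : EuclideanSpace ℂ (Fin N)) := by fun_prop
    exact hc.comp_aestronglyMeasurable hg.locInt_grad.aestronglyMeasurable
  integral_eq η hη k := by
    have e := congrArg conj (hg.integral_eq η hη k)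
    rw [map_neg, ← integral_conj, ← integral_conj] at e
    simpa using e

/-- The conjugate of a weak gradient is a weak gradient of the conjugate, here of the same function,
so uniqueness applies. This is why a real profile carries no current. -/
lemma HasWeakGrad.im_eq_zero {r : Space N → ℝ} {g : Space N → EuclideanSpace ℂ (Fin N)}
    (hg : HasWeakGrad (fun x => (r x : ℂ)) g) : ∀ᵐ x, ∀ k, (g x k).im = 0 := by
  have h := hg.conj
  simp only [Complex.conj_ofReal] at h
  filter_upwards [hg.ae_unique h] with x hx k
  have := congrArg (fun v : EuclideanSpace ℂ (Fin N) => v k) hx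
  exact Complex.conj_eq_iff_im.1 this.symm

/-! ### Functions with bounded derivatives up to order three -/

/-- `f` is of class `C^3` and its derivatives of order at most three are bounded by `B` in
operator norm. -/
structure C3Bound {F : Type*} [NormedAddCommGroup F] [NormedSpace ℝ F]
    (f : Space N → F) (B : ℝ) : Prop where
  contDiff : ContDiff ℝ 3 f
  bound : ∀ n ≤ 3, ∀ x, ‖iteratedFDeriv ℝ n f x‖ ≤ B

section

variable {F : Type*} [NormedAddCommGroup F] [NormedSpace ℝ F]

lemma ContinuousMultilinearMap.norm_le_sum_stdVec {n : ℕ}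
    (T : ContinuousMultilinearMap ℝ (fun _ : Fin n => Space N) F) :
    ‖T‖ ≤ ∑ s : Fin n → Fin N, ‖T fun i => stdVec (s i)‖ := by
  refine T.opNorm_le_bound (by positivity) fun v => ?_
  have hv : v = fun i => ∑ k, v i k • (stdVec k : Space N) := by
    funext i
    ext l
    simp [Finset.sum_apply, Pi.single_apply]
  have : T v = ∑ s : Fin n → Fin N, (∏ i, v i (s i)) • T fun i => stdVec (s i) := by
    conv_lhs => rw [hv]
    rw [T.map_sum]
    exact Finset.sum_congr rfl fun s _ => T.map_smul_univ _ _
  rw [this, Finset.sum_mul]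
  refine (norm_sum_le _ _).trans (Finset.sum_le_sum fun s _ => ?_)
  rw [norm_smul, mul_comm, norm_prod]
  gcongr with i
  exact PiLp.norm_apply_le (v i) (s i)

lemma iteratedFDeriv_two_symm {f : Space N → F} (hf : ContDiff ℝ 2 f) (x a b : Space N) :
    iteratedFDeriv ℝ 2 f x ![a, b] = iteratedFDeriv ℝ 2 f x ![b, a] := by
  have h : IsSymmSndFDerivAt ℝ f x := hf.contDiffAt.isSymmSndFDerivAt (by simp)
  rw [iteratedFDeriv_two_apply, iteratedFDeriv_two_apply]
  exact h a b

/-- The third derivative is the second derivative of `fderiv ℝ f` evaluated at the last vector, and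
that second derivative is symmetric. -/
lemma iteratedFDeriv_three_swap_left {f : Space N → F} (hf : ContDiff ℝ 3 f)
    (x a b c : Space N) :
    iteratedFDeriv ℝ 3 f x ![a, b, c] = iteratedFDeriv ℝ 3 f x ![b, a, c] := by
  have h := iteratedFDeriv_two_symm (hf.fderiv_right (m := 2) (by norm_num)) x a b
  have e' := fun v : Fin 3 → Space N =>
    iteratedFDeriv_succ_apply_right (𝕜 := ℝ) (f := f) (x := x) (n := 2) v
  have e : ∀ a b : Space N, Fin.init ![a, b, c] = ![a, b] := fun a b => by
    funext i; fin_cases i <;> rfl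
  rw [e', e', e, e]
  exact congrArg (fun T : Space N →L[ℝ] F => T c) h

/-- Here the third derivative is the derivative, in the direction of the first vector, of the
symmetric second derivative of `f`. -/
lemma iteratedFDeriv_three_swap_right {f : Space N → F} (hf : ContDiff ℝ 3 f)
    (x a b c : Space N) :
    iteratedFDeriv ℝ 3 f x ![a, b, c] = iteratedFDeriv ℝ 3 f x ![a, c, b] := by
  have hd : DifferentiableAt ℝ (iteratedFDeriv ℝ 2 f) x :=
    (hf.differentiable_iteratedFDeriv (by norm_num)).differentiableAt
  have h : ∀ v : Fin 2 → Space N, fderiv ℝ (iteratedFDeriv ℝ 2 f) x a v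
      = fderiv ℝ (fun y => iteratedFDeriv ℝ 2 f y v) x a := fun v => by
    have := (ContinuousMultilinearMap.apply ℝ (fun _ : Fin 2 => Space N) F v).hasFDerivAt.comp x
      hd.hasFDerivAt
    exact (congrArg (fun T : Space N →L[ℝ] F => T a) this.fderiv).symm
  rw [iteratedFDeriv_succ_apply_left, iteratedFDeriv_succ_apply_left]
  change fderiv ℝ (iteratedFDeriv ℝ 2 f) x a ![b, c] = fderiv ℝ (iteratedFDeriv ℝ 2 f) x a ![c, b]
  rw [h, h]
  congr 2
  funext y
  exact iteratedFDeriv_two_symm (hf.of_le (by norm_num)) y b c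

/-- `ckNorm` lists only nondecreasing multi-indices, whereas the operator norm involves all of them.
Adjacent transpositions generate every reordering, so sorting loses nothing. -/
lemma exists_monotone_iteratedFDeriv_eq {f : Space N → F} (hf : ContDiff ℝ 3 f) {n : ℕ}
    (hn : n ≤ 3) (s : Fin n → Fin N) (x : Space N) :
    ∃ s' : Fin n → Fin N, Monotone s' ∧ iteratedFDeriv ℝ n f x (fun i => stdVec (s i))
      = iteratedFDeriv ℝ n f x (fun i => stdVec (s' i)) := by
  interval_cases n
  · exact ⟨s, fun i => i.elim0, rfl⟩
  · exact ⟨s, fun i j _ => by rw [Subsingleton.elim i j], rfl⟩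
  · have hv : ∀ s : Fin 2 → Fin N, (fun i => (stdVec (s i) : Space N))
        = ![stdVec (s 0), stdVec (s 1)] := fun s => by
      funext i; fin_cases i <;> rfl
    have hmono : ∀ i j : Fin N, i ≤ j → Monotone ![i, j] := fun i j h => by
      rw [Fin.monotone_iff_le_succ]; intro k; fin_cases k; exact h
    rcases le_total (s 0) (s 1) with h | h
    · exact ⟨![s 0, s 1], hmono _ _ h, by rw [hv s, hv ![s 0, s 1]]; rfl⟩
    · refine ⟨![s 1, s 0], hmono _ _ h, ?_⟩
      rw [hv s, hv ![s 1, s 0], iteratedFDeriv_two_symm (hf.of_le (by norm_num))]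
      rfl
  · have hv : ∀ s : Fin 3 → Fin N, (fun i => (stdVec (s i) : Space N))
        = ![stdVec (s 0), stdVec (s 1), stdVec (s 2)] := fun s => by
      funext i; fin_cases i <;> rfl
    have hmono : ∀ i j k : Fin N, i ≤ j → j ≤ k → Monotone ![i, j, k] := fun i j k h h' => by
      rw [Fin.monotone_iff_le_succ]; intro l; fin_cases l; exacts [h, h']
    have hl := fun a b c => iteratedFDeriv_three_swap_left hf x a b c
    have hr := fun a b c => iteratedFDeriv_three_swap_right hf x a b c
    rw [hv s]
    suffices ∃ i j k : Fin N, i ≤ j ∧ j ≤ k ∧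
        iteratedFDeriv ℝ 3 f x ![stdVec (s 0), stdVec (s 1), stdVec (s 2)]
          = iteratedFDeriv ℝ 3 f x ![stdVec i, stdVec j, stdVec k] by
      obtain ⟨i, j, k, h, h', e⟩ := this
      exact ⟨![i, j, k], hmono i j k h h', by rw [e, hv ![i, j, k]]; rfl⟩
    rcases le_total (s 0) (s 1) with h | h <;> rcases le_total (s 1) (s 2) with h' | h' <;>
      rcases le_total (s 0) (s 2) with h'' | h''
    · exact ⟨_, _, _, h, h', rfl⟩
    · exact ⟨_, _, _, h, h', rfl⟩
    · exact ⟨_, _, _, h'', h', hr _ _ _⟩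
    · exact ⟨_, _, _, h'', h, (hr _ _ _).trans (hl _ _ _)⟩
    · exact ⟨_, _, _, h, h'', hl _ _ _⟩
    · exact ⟨_, _, _, h', h'', (hl _ _ _).trans (hr _ _ _)⟩
    · exact ⟨_, _, _, h', h, ((hr _ _ _).trans (hl _ _ _)).trans (hr _ _ _)⟩
    · exact ⟨_, _, _, h', h, ((hr _ _ _).trans (hl _ _ _)).trans (hr _ _ _)⟩

lemma pow_le_pow_three (N : ℕ) {n : ℕ} (hn : n ≤ 3) : ((N : ℝ) ^ n) ≤ ((N : ℝ) + 1) ^ 3 := by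
  calc (N : ℝ) ^ n ≤ ((N : ℝ) + 1) ^ n := by gcongr; linarith
    _ ≤ ((N : ℝ) + 1) ^ 3 := pow_le_pow_right₀ (by linarith [Nat.cast_nonneg (α := ℝ) N]) hn

lemma norm_iteratedFDeriv_le_ckNorm {f : Space N → F} (hfin : ckNorm 3 f < ⊤) {n : ℕ} (hn : n ≤ 3)
    {s : Fin n → Fin N} (hs : Monotone s) (x : Space N) :
    ‖iteratedFDeriv ℝ n f x fun i => stdVec (s i)‖ ≤ (ckNorm 3 f).toReal := by
  rw [← toReal_enorm]
  refine ENNReal.toReal_mono hfin.ne ?_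
  refine (le_iSup (fun x => ‖iteratedFDeriv ℝ n f x fun i => stdVec (s i)‖ₑ) x).trans ?_
  refine le_trans ?_ (Finset.single_le_sum (f := fun n => ∑ s : {s : Fin n → Fin N // Monotone s},
    ⨆ x, ‖iteratedFDeriv ℝ n f x (fun i => stdVec (s.1 i))‖ₑ) (fun _ _ => zero_le)
    (Finset.mem_range.2 (Nat.lt_succ_of_le hn)))
  exact Finset.single_le_sum (f := fun s : {s : Fin n → Fin N // Monotone s} =>
    ⨆ x, ‖iteratedFDeriv ℝ n f x (fun i => stdVec (s.1 i))‖ₑ) (fun _ _ => zero_le)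
    (Finset.mem_univ ⟨s, hs⟩)

lemma C3Bound.of_ckNorm {f : Space N → F} (hf : ContDiff ℝ 3 f) (hfin : ckNorm 3 f < ⊤) :
    C3Bound f (((N : ℝ) + 1) ^ 3 * (ckNorm 3 f).toReal) := by
  refine ⟨hf, fun n hn x => ?_⟩
  refine (ContinuousMultilinearMap.norm_le_sum_stdVec _).trans ?_
  calc ∑ s : Fin n → Fin N, ‖iteratedFDeriv ℝ n f x fun i => stdVec (s i)‖
      ≤ ∑ _s : Fin n → Fin N, (ckNorm 3 f).toReal := by
        refine Finset.sum_le_sum fun s _ => ?_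
        obtain ⟨s', hs', e⟩ := exists_monotone_iteratedFDeriv_eq hf hn s x
        rw [e]
        exact norm_iteratedFDeriv_le_ckNorm hfin hn hs' x
    _ = (N : ℝ) ^ n * (ckNorm 3 f).toReal := by simp
    _ ≤ _ := by gcongr; exact pow_le_pow_three N hn

lemma C3Bound.nonneg {f : Space N → F} {B : ℝ} (hf : C3Bound f B) : 0 ≤ B :=
  (norm_nonneg _).trans (hf.bound 0 (by norm_num) 0)

lemma C3Bound.norm_le {f : Space N → F} {B : ℝ} (hf : C3Bound f B) (x : Space N) : ‖f x‖ ≤ B := by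
  simpa using hf.bound 0 (by norm_num) x

lemma C3Bound.continuous {f : Space N → F} {B : ℝ} (hf : C3Bound f B) : Continuous f :=
  hf.contDiff.continuous

/-- The constant comparing the operator-norm bounds of `C3Bound` with `ckNorm 3`. -/
def ckConst (N : ℕ) : ℝ := 4 * ((N : ℝ) + 1) ^ 3

lemma ckConst_pos (N : ℕ) : 0 < ckConst N := by unfold ckConst; positivity

/-- The factor `4` in `ckConst` counts the orders `0, …, 3`; `(N+1)^3` bounds the number of
multi-indices of each order, which is at most `N^n`. -/
lemma C3Bound.ckNorm_le {f : Space N → F} {B : ℝ} (hf : C3Bound f B) :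
    ckNorm 3 f ≤ ENNReal.ofReal (ckConst N * B) := by
  have h1 : ∀ n ∈ Finset.range (3 + 1), ∑ s : {s : Fin n → Fin N // Monotone s},
      ⨆ x, ‖iteratedFDeriv ℝ n f x (fun i => stdVec (s.1 i))‖ₑ
        ≤ ENNReal.ofReal (((N : ℝ) + 1) ^ 3 * B) := fun n hn => by
    have hn' : n ≤ 3 := Nat.lt_succ_iff.1 (Finset.mem_range.1 hn)
    calc _ ≤ ∑ _s : {s : Fin n → Fin N // Monotone s}, ENNReal.ofReal B := by
          refine Finset.sum_le_sum fun s _ => iSup_le fun x => ?_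
          rw [← ofReal_norm]
          refine ENNReal.ofReal_le_ofReal ?_
          refine ((iteratedFDeriv ℝ n f x).le_opNorm _).trans ?_
          simpa using hf.bound n hn' x
      _ ≤ ENNReal.ofReal (((N : ℝ) + 1) ^ 3 * B) := by
          rw [Finset.sum_const, nsmul_eq_mul, ENNReal.ofReal_mul (by positivity)]
          gcongr
          rw [← ENNReal.ofReal_natCast]
          refine ENNReal.ofReal_le_ofReal (le_trans ?_ (pow_le_pow_three N hn'))
          have : Fintype.card {s : Fin n → Fin N // Monotone s} ≤ N ^ n := by
            refine (Fintype.card_subtype_le _).trans ?_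
            simp
          exact_mod_cast this
  refine (Finset.sum_le_sum h1).trans ?_
  rw [Finset.sum_const, nsmul_eq_mul, Finset.card_range, ckConst, mul_assoc,
    ENNReal.ofReal_mul (by norm_num : (0 : ℝ) ≤ 4)]
  norm_num

lemma C3Bound.comp_const_sub {f : Space N → F} {B : ℝ} (hf : C3Bound f B) (w : Space N) :
    C3Bound (fun z => f (w - z)) B := by
  refine ⟨hf.contDiff.comp (contDiff_const.sub contDiff_id), fun n hn x => ?_⟩
  have h := (LinearIsometryEquiv.neg ℝ (E := Space N)).norm_iteratedFDeriv_comp_right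
    (fun z => f (w + z)) x n
  have e : (fun z => f (w + z)) ∘ (LinearIsometryEquiv.neg ℝ (E := Space N))
      = fun z => f (w - z) := by
    funext z; simp [sub_eq_add_neg]
  rw [e, iteratedFDeriv_comp_add_left] at h
  rw [h]
  exact hf.bound n hn _

lemma C3Bound.const_sub {f : Space N → F} {B : ℝ} (hf : C3Bound f B) (b : F) :
    C3Bound (fun z => b - f z) (‖b‖ + B) := by
  refine ⟨contDiff_const.sub hf.contDiff, fun n hn x => ?_⟩
  have hn' : (n : WithTop ℕ∞) ≤ 3 := by exact_mod_cast hn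
  have h := iteratedFDeriv_sub_apply (𝕜 := ℝ) (i := n) (f := fun _ : Space N => b) (g := f) (x := x)
    contDiff_const.contDiffAt (hf.contDiff.contDiffAt.of_le hn')
  change ‖iteratedFDeriv ℝ n ((fun _ => b) - f) x‖ ≤ _
  rw [h]
  refine (norm_sub_le _ _).trans (add_le_add ?_ (hf.bound n hn x))
  rcases Nat.eq_zero_or_pos n with rfl | hpos
  · simp
  · rw [iteratedFDeriv_const_of_ne (by omega)]
    simp

/-- Leibniz rule for the inner product: the binomial coefficients of order `n` sum to `2^n ≤ 8`. -/
lemma C3Bound.normSq {f : Space N → Space N} {B : ℝ} (hf : C3Bound f B) :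
    C3Bound (fun z => ‖f z‖ ^ 2) (8 * B ^ 2) := by
  have hB := hf.nonneg
  have e : (fun z => ‖f z‖ ^ 2) = fun z => innerSL ℝ (f z) (f z) := by
    funext z; simp
  refine ⟨hf.contDiff.norm_sq ℝ, fun n hn x => ?_⟩
  have hn' : (n : WithTop ℕ∞) ≤ 3 := by exact_mod_cast hn
  rw [e]
  refine ((innerSL ℝ (E := Space N)).norm_iteratedFDeriv_le_of_bilinear_of_le_one
    hf.contDiff hf.contDiff x hn' (norm_innerSL_le ℝ)).trans ?_
  calc ∑ i ∈ Finset.range (n + 1), (n.choose i : ℝ) * ‖iteratedFDeriv ℝ i f x‖ *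
        ‖iteratedFDeriv ℝ (n - i) f x‖
      ≤ ∑ i ∈ Finset.range (n + 1), (n.choose i : ℝ) * B ^ 2 := by
        refine Finset.sum_le_sum fun i hi => ?_
        have hi' : i ≤ n := Nat.lt_succ_iff.1 (Finset.mem_range.1 hi)
        rw [mul_assoc, sq]
        gcongr
        · exact hf.bound i (hi'.trans hn) x
        · exact hf.bound (n - i) ((Nat.sub_le _ _).trans hn) x
    _ = (2 : ℝ) ^ n * B ^ 2 := by
        rw [← Finset.sum_mul, ← Nat.cast_sum, Nat.sum_range_choose]; simp
    _ ≤ 8 * B ^ 2 := by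
        have : (2 : ℝ) ^ n ≤ 2 ^ 3 := pow_le_pow_right₀ (by norm_num) hn
        nlinarith [sq_nonneg B]

/-- Second order Taylor estimate. -/
lemma C3Bound.taylor {f : Space N → ℝ} {B : ℝ} (hf : C3Bound f B) (z h : Space N) :
    |f (z + h) - f z - fderiv ℝ f z h| ≤ B * ‖h‖ ^ 2 := by
  have hd : Differentiable ℝ f := hf.contDiff.differentiable (by norm_num)
  have hd2 : Differentiable ℝ (fderiv ℝ f) :=
    (hf.contDiff.fderiv_right (m := 2) (by norm_num)).differentiable (by norm_num)
  have hB : ∀ x, ‖fderiv ℝ (fderiv ℝ f) x‖ ≤ B := fun x => by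
    rw [← norm_iteratedFDeriv_one, norm_iteratedFDeriv_fderiv]
    exact hf.bound 2 (by norm_num) x
  have hlip : ∀ w, ‖fderiv ℝ f w - fderiv ℝ f z‖ ≤ B * ‖w - z‖ := fun w =>
    convex_univ.norm_image_sub_le_of_norm_fderiv_le (fun x _ => hd2 x) (fun x _ => hB x)
      (mem_univ z) (mem_univ w)
  have := (convex_closedBall z ‖h‖).norm_image_sub_le_of_norm_fderiv_le' (f := f)
    (φ := fderiv ℝ f z) (C := B * ‖h‖) (x := z) (y := z + h) (fun x _ => hd x) (fun w hw => by
      refine (hlip w).trans ?_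
      have hB0 := hf.nonneg
      gcongr
      simpa [dist_eq_norm] using hw) (by simp) (by simp [dist_eq_norm])
  simpa [sq, mul_assoc] using this

/-- There is a smooth bump function at the origin, supported in the unit ball. -/
lemma exists_bump (N : ℕ) : ∃ (ζ : Space N → ℝ) (B : ℝ), C3Bound ζ B ∧ ζ 0 = 1 ∧
    (∀ x, 0 ≤ ζ x) ∧ (∀ x, ζ x ≤ 1) ∧ ∀ x, 1 ≤ ‖x‖ → ζ x = 0 := by
  let f : ContDiffBump (0 : Space N) := ⟨1 / 2, 1, by norm_num, by norm_num⟩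
  have hf : ContDiff ℝ 3 f := f.contDiff
  have hb : ∀ n : ℕ, n ≤ 3 → ∃ C, ∀ x, ‖iteratedFDeriv ℝ n f x‖ ≤ C := fun n hn =>
    (hf.continuous_iteratedFDeriv (by exact_mod_cast hn)).bounded_above_of_compact_support
      (f.hasCompactSupport.iteratedFDeriv n)
  choose! C hC using hb
  refine ⟨f, ∑ n ∈ Finset.range 4, |C n|, ⟨hf, fun n hn x => ?_⟩, ?_, fun x => f.nonneg,
    fun x => f.le_one, fun x hx => ?_⟩
  · refine ((hC n hn x).trans (le_abs_self _)).trans ?_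
    exact Finset.single_le_sum (f := fun n => |C n|) (fun _ _ => abs_nonneg _)
      (Finset.mem_range.2 (by omega))
  · exact f.one_of_mem_closedBall (by simp [f])
  · exact f.zero_of_le_dist (by simpa [f] using hx)

end

/-! ### The space `H^1` -/

lemma integrable_normSq {F : Type*} [NormedAddCommGroup F] {f : Space N → F}
    (hf : MemLp f 2 volume) : Integrable fun x => ‖f x‖ ^ 2 :=
  (memLp_two_iff_integrable_sq_norm hf.1).1 hf

lemma memLp_comp_add {F : Type*} [NormedAddCommGroup F] {f : Space N → F}
    (hf : MemLp f 2 volume) (a : Space N) : MemLp (fun x => f (x + a)) 2 volume :=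
  hf.comp_measurePreserving (measurePreserving_add_right volume a)

lemma integral_normSq_sub_le {F : Type*} [NormedAddCommGroup F] {f g : Space N → F}
    (hf : MemLp f 2 volume) (hg : MemLp g 2 volume) :
    ∫ x, ‖f x - g x‖ ^ 2 ≤ 2 * (∫ x, ‖f x‖ ^ 2) + 2 * ∫ x, ‖g x‖ ^ 2 := by
  rw [← integral_const_mul, ← integral_const_mul,
    ← integral_add ((integrable_normSq hf).const_mul 2) ((integrable_normSq hg).const_mul 2)]
  refine integral_mono (integrable_normSq (hf.sub hg))
    (((integrable_normSq hf).const_mul 2).add ((integrable_normSq hg).const_mul 2)) fun x => ?_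
  have := norm_sub_le (f x) (g x)
  simp only
  nlinarith [norm_nonneg (f x - g x), norm_nonneg (f x), norm_nonneg (g x),
    sq_nonneg (‖f x‖ - ‖g x‖)]

lemma HasWeakGrad.h1NormSq_eq {u : Space N → ℂ} {g : Space N → EuclideanSpace ℂ (Fin N)}
    (hg : HasWeakGrad u g) : h1NormSq u = (∫ x, ‖g x‖ ^ 2) + ∫ x, ‖u x‖ ^ 2 := by
  rw [h1NormSq]
  congr 1
  refine integral_congr_ae ?_
  filter_upwards [hg.weakGrad_ae_eq] with x hx using by rw [hx]

lemma h1NormSq_nonneg (u : Space N → ℂ) : 0 ≤ h1NormSq u :=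
  add_nonneg (integral_nonneg fun _ => by positivity) (integral_nonneg fun _ => by positivity)

lemma integral_normSq_le_h1NormSq (u : Space N → ℂ) : ∫ x, ‖u x‖ ^ 2 ≤ h1NormSq u :=
  le_add_of_nonneg_left (integral_nonneg fun _ => by positivity)

lemma MemH1.hasWeakGrad {u : Space N → ℂ} (hu : MemH1 u) : HasWeakGrad u (weakGrad u) :=
  hu.2.choose_spec.1.weakGrad

lemma MemH1.memLp_weakGrad {u : Space N → ℂ} (hu : MemH1 u) : MemLp (weakGrad u) 2 volume := by
  obtain ⟨g, hg, hg2⟩ := hu.2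
  exact hg2.ae_eq hg.weakGrad_ae_eq.symm

lemma MemH1.sub {u v : Space N → ℂ} (hu : MemH1 u) (hv : MemH1 v) :
    MemH1 fun x => u x - v x :=
  ⟨hu.1.sub hv.1, _, hu.hasWeakGrad.sub hv.hasWeakGrad, hu.memLp_weakGrad.sub hv.memLp_weakGrad⟩

lemma MemH1.comp_add {u : Space N → ℂ} (hu : MemH1 u) (a : Space N) :
    MemH1 fun x => u (x + a) :=
  ⟨memLp_comp_add hu.1 a, _, hu.hasWeakGrad.comp_add a, memLp_comp_add hu.memLp_weakGrad a⟩

lemma MemH1.memLp_add_imVec {u : Space N → ℂ} (hu : MemH1 u) (b : Space N) :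
    MemLp (fun x => weakGrad u x + u x • imVec b) 2 volume := by
  refine hu.memLp_weakGrad.add ?_
  refine MemLp.of_le_mul (c := ‖b‖) hu.1 (hu.1.1.smul_const _) (Eventually.of_forall fun x => ?_)
  simp [norm_smul, mul_comm]

lemma MemH1.planeWave_mul {u : Space N → ℂ} (hu : MemH1 u) (b : Space N) (κ : ℝ) :
    MemH1 fun x => planeWave b κ x * u x := by
  have hw := (continuous_planeWave b κ).aestronglyMeasurable (μ := volume)
  have h := hu.memLp_add_imVec b
  refine ⟨hu.1.of_le (hw.mul hu.1.1) (Eventually.of_forall fun x => by simp), _,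
    hu.hasWeakGrad.planeWave_mul b κ,
    h.of_le (hw.smul h.1) (Eventually.of_forall fun x => ?_)⟩
  rw [norm_smul, norm_planeWave, one_mul]

lemma h1NormSq_sub_le {u v : Space N → ℂ} (hu : MemH1 u) (hv : MemH1 v) :
    h1NormSq (fun x => u x - v x) ≤ 2 * h1NormSq u + 2 * h1NormSq v := by
  rw [(hu.hasWeakGrad.sub hv.hasWeakGrad).h1NormSq_eq, h1NormSq, h1NormSq]
  have h1 := integral_normSq_sub_le hu.memLp_weakGrad hv.memLp_weakGrad
  have h2 := integral_normSq_sub_le hu.1 hv.1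
  linarith

lemma h1NormSq_comp_add {u : Space N → ℂ} (hu : MemH1 u) (a : Space N) :
    h1NormSq (fun x => u (x + a)) = h1NormSq u := by
  rw [(hu.hasWeakGrad.comp_add a).h1NormSq_eq, h1NormSq,
    integral_add_right_eq_self (fun x => ‖weakGrad u x‖ ^ 2) a,
    integral_add_right_eq_self (fun x => ‖u x‖ ^ 2) a]

/-- The gradient of the product has modulus `|∇u + i b u|`, so only the frequency `b` matters. In
the application it is `ξ + A(εX)`, which stays bounded along the trajectory. -/
lemma h1NormSq_planeWave_mul_le {u : Space N → ℂ} (hu : MemH1 u) (b : Space N) (κ : ℝ) :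
    h1NormSq (fun x => planeWave b κ x * u x) ≤ (2 + 2 * ‖b‖ ^ 2) * h1NormSq u := by
  rw [(hu.hasWeakGrad.planeWave_mul b κ).h1NormSq_eq, h1NormSq]
  have hb : MemLp (fun x => -(u x • imVec b)) 2 volume := by
    refine MemLp.of_le_mul (c := ‖b‖) hu.1 (hu.1.1.smul_const _).neg
      (Eventually.of_forall fun x => ?_)
    simp [norm_smul, mul_comm]
  have h1 := integral_normSq_sub_le hu.memLp_weakGrad hb
  have e1 : ∀ x, ‖planeWave b κ x • (weakGrad u x + u x • imVec b)‖
      = ‖weakGrad u x - -(u x • imVec b)‖ := fun x => by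
    rw [norm_smul, norm_planeWave, one_mul, sub_neg_eq_add]
  have e2 : ∀ x, ‖-(u x • imVec b)‖ ^ 2 = ‖b‖ ^ 2 * ‖u x‖ ^ 2 := fun x => by
    rw [norm_neg, norm_smul, norm_imVec]; ring
  simp only [e2, integral_const_mul] at h1
  simp only [e1, norm_mul, norm_planeWave, one_mul]
  have g0 : 0 ≤ ∫ x, ‖weakGrad u x‖ ^ 2 := integral_nonneg fun _ => by positivity
  have u0 : 0 ≤ ∫ x, ‖u x‖ ^ 2 := integral_nonneg fun _ => by positivity
  nlinarith [mul_nonneg (sq_nonneg ‖b‖) g0]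

lemma weakGrad_congr {u v : Space N → ℂ} (hu : ∃ g, HasWeakGrad u g) (h : u =ᵐ[volume] v) :
    weakGrad u =ᵐ[volume] weakGrad v := by
  obtain ⟨g, hg⟩ := hu
  exact hg.weakGrad_ae_eq.trans (hg.congr h).weakGrad_ae_eq.symm

/-! ### The magnetic gradient -/

lemma weakGrad_eq_magGrad (A : Space N → Space N) (ε : ℝ) (u : Space N → ℂ) (x : Space N) :
    weakGrad u x = Complex.I • magGrad A ε u x + u x • imVec (A (ε • x)) := by
  ext k
  simp only [magGrad, PiLp.add_apply, PiLp.smul_apply, imVec_apply, smul_eq_mul]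
  linear_combination (weakGrad u x k) * Complex.I_sq

lemma continuous_imVec : Continuous (imVec : Space N → EuclideanSpace ℂ (Fin N)) := by
  unfold imVec; fun_prop

lemma memLp_smul_imVec {u : Space N → ℂ} (hu : MemLp u 2 volume) {A : Space N → Space N} {B : ℝ}
    (hA : Continuous A) (hB : ∀ x, ‖A x‖ ≤ B) (ε : ℝ) :
    MemLp (fun x => u x • imVec (A (ε • x))) 2 volume := by
  refine MemLp.of_le_mul (c := B) hu (hu.1.smul
    (continuous_imVec.comp (hA.comp (continuous_const_smul ε))).aestronglyMeasurable)
    (Eventually.of_forall fun x => ?_)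
  rw [norm_smul, norm_imVec, mul_comm]
  gcongr
  exact hB _

/-- Since `∇u = i Du + i A(εx) u` with `A` bounded, `∇u` is square integrable as soon as `Du` and
`u` are. -/
lemma MemHA.memH1 {P : Potentials N} {ε B : ℝ} {u : Fin m → Space N → ℂ} (hu : MemHA P ε u)
    (hA : Continuous P.A) (hB : ∀ x, ‖P.A x‖ ≤ B) (j : Fin m) : MemH1 (u j) := by
  obtain ⟨h1, ⟨g, hg⟩, h3, -⟩ := hu.1 j
  refine ⟨h1, _, hg.weakGrad, ?_⟩
  have := (h3.const_smul Complex.I).add (memLp_smul_imVec h1 hA hB ε)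
  refine this.ae_eq (Eventually.of_forall fun x => ?_)
  simp [weakGrad_eq_magGrad P.A ε (u j) x]

lemma MemH1.memLp_magGrad {A : Space N → Space N} {ε B : ℝ} {u : Space N → ℂ} (hu : MemH1 u)
    (hA : Continuous A) (hB : ∀ x, ‖A x‖ ≤ B) : MemLp (magGrad A ε u) 2 volume := by
  have := (hu.memLp_weakGrad.sub (memLp_smul_imVec hu.1 hA hB ε)).const_smul (-Complex.I)
  refine this.ae_eq (Eventually.of_forall fun x => ?_)
  simp [weakGrad_eq_magGrad A ε u x, smul_smul]

/-- The magnetic current `Im(\bar u (∇u - i A(ε x) u))` of a scalar function. -/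
def current (A : Space N → Space N) (ε : ℝ) (u : Space N → ℂ) (x : Space N) : Space N :=
  WithLp.toLp 2 fun k =>
    (conj (u x) * (weakGrad u x k - Complex.I * ((A (ε • x) k : ℝ) : ℂ) * u x)).im

lemma momentum_eq_sum (A : Space N → Space N) (ε : ℝ) (u : Fin m → Space N → ℂ) (x : Space N) :
    momentum A ε u x = ∑ j, current A ε (u j) x := by
  ext k
  simp [momentum, current]

lemma current_eq (A : Space N → Space N) (ε : ℝ) (u : Space N → ℂ) (x : Space N) :
    current A ε u x = WithLp.toLp 2 fun k =>
      ((conj (u x) • Complex.I • magGrad A ε u x : EuclideanSpace ℂ (Fin N)) k).im := by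
  ext k
  simp only [current, weakGrad_eq_magGrad A ε u x, PiLp.add_apply, PiLp.smul_apply, imVec_apply,
    smul_eq_mul]
  congr 1
  ring

lemma MemH1.integrable_current {A : Space N → Space N} {ε B : ℝ} {u : Space N → ℂ}
    (hu : MemH1 u) (hA : Continuous A) (hB : ∀ x, ‖A x‖ ≤ B) :
    Integrable (current A ε u) := by
  have hG := hu.memLp_magGrad (ε := ε) hA hB
  have hp : Integrable fun x => ‖u x‖ * ‖magGrad A ε u x‖ :=
    MemLp.integrable_mul (p := 2) (q := 2) hu.1.norm hG.norm
  refine hp.mono ?_ (Eventually.of_forall fun x => ?_)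
  · have hc : Continuous fun v : EuclideanSpace ℂ (Fin N) =>
        (WithLp.toLp 2 fun k => (v k).im : Space N) := by fun_prop
    have hm : AEStronglyMeasurable (fun x => conj (u x) • Complex.I • magGrad A ε u x) volume :=
      (Complex.continuous_conj.comp_aestronglyMeasurable hu.1.1).smul (hG.1.const_smul Complex.I)
    refine (hc.comp_aestronglyMeasurable hm).congr (Eventually.of_forall fun x => ?_)
    simp only [current_eq]
  · have : ‖current A ε u x‖ ≤ ‖(conj (u x) • Complex.I • magGrad A ε u x)‖ := by
      rw [current_eq, EuclideanSpace.norm_eq, EuclideanSpace.norm_eq]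
      gcongr with k
      exact Complex.abs_im_le_norm _
    refine this.trans ?_
    rw [norm_smul, norm_smul]
    simp

/-- Expansion of `∇u - i b u = i (Du - (b - A(εx)) u)`. The cross term is the current because `Re(ū
Du) = Im(ū (∇u - i A(εx) u))`. -/
lemma normSq_sub_smul_imVec (A : Space N → Space N) (ε : ℝ) (u : Space N → ℂ) (b x : Space N) :
    ‖weakGrad u x - u x • imVec b‖ ^ 2 = ‖magGrad A ε u x‖ ^ 2
      + ‖b - A (ε • x)‖ ^ 2 * ‖u x‖ ^ 2 - 2 * inner ℝ (b - A (ε • x)) (current A ε u x) := by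
  simp only [EuclideanSpace.norm_sq_eq, PiLp.inner_apply, Finset.sum_mul, Finset.mul_sum]
  rw [← Finset.sum_add_distrib, ← Finset.sum_sub_distrib]
  refine Finset.sum_congr rfl fun k _ => ?_
  simp only [magGrad, current, PiLp.sub_apply, PiLp.smul_apply, imVec_apply, smul_eq_mul,
    Complex.sq_norm, Complex.normSq_apply, Real.norm_eq_abs, sq_abs, RCLike.inner_apply]
  simp
  ring

/-! ### Gradient, energy and mass of the recentred function -/

lemma recentred_eq (A : Space N → Space N) (ε : ℝ) (u : Fin m → Space N → ℂ) (X Ξ : Space N)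
    (j : Fin m) : recentred A ε u X Ξ j = fun x =>
      planeWave (-(Ξ + A (ε • X))) (-inner ℝ Ξ X) x * u j (x + X) := by
  funext x
  rw [recentred, planeWave, ← Complex.exp_add]
  congr 2
  simp only [inner_add_right, inner_neg_left, inner_add_left]
  push_cast
  ring

lemma memH1_recentred {A : Space N → Space N} {ε : ℝ} {u : Fin m → Space N → ℂ} {X Ξ : Space N}
    {j : Fin m} (hu : MemH1 (u j)) : MemH1 (recentred A ε u X Ξ j) := by
  rw [recentred_eq]
  exact (hu.comp_add X).planeWave_mul _ _

lemma norm_recentred (A : Space N → Space N) (ε : ℝ) (u : Fin m → Space N → ℂ) (X Ξ : Space N)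
    (j : Fin m) (x : Space N) : ‖recentred A ε u X Ξ j x‖ = ‖u j (x + X)‖ := by
  rw [recentred_eq]; simp

lemma integral_normSq_weakGrad_recentred {A : Space N → Space N} {ε : ℝ}
    {u : Fin m → Space N → ℂ} {j : Fin m} (hu : MemH1 (u j)) (X Ξ : Space N) :
    ∫ x, ‖weakGrad (recentred A ε u X Ξ j) x‖ ^ 2
      = ∫ x, ‖weakGrad (u j) x - u j x • imVec (Ξ + A (ε • X))‖ ^ 2 := by
  rw [← integral_add_right_eq_self (fun x => ‖weakGrad (u j) x - _‖ ^ 2) X, recentred_eq]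
  refine integral_congr_ae ?_
  filter_upwards [((hu.hasWeakGrad.comp_add X).planeWave_mul (-(Ξ + A (ε • X)))
    (-inner ℝ Ξ X)).weakGrad_ae_eq] with x hx
  have hneg : imVec (-(Ξ + A (ε • X))) = -imVec (Ξ + A (ε • X)) := by
    ext k
    simp
    ring
  rw [hx, norm_smul, norm_planeWave, one_mul, hneg, smul_neg, ← sub_eq_add_neg]

lemma integrable_density {u : Fin m → Space N → ℂ} (hu : ∀ j, MemH1 (u j)) :
    Integrable (density u) :=
  integrable_finsetSum _ fun j _ => integrable_normSq (hu j).1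

lemma integrable_momentum {A : Space N → Space N} {ε B : ℝ} {u : Fin m → Space N → ℂ}
    (hu : ∀ j, MemH1 (u j)) (hA : Continuous A) (hB : ∀ x, ‖A x‖ ≤ B) :
    Integrable (momentum A ε u) := by
  simp only [funext (momentum_eq_sum A ε u)]
  exact integrable_finsetSum _ fun j _ => (hu j).integrable_current hA hB

lemma integrable_bdd_mul {f ρ : Space N → ℝ} (hρ : Integrable ρ) (hf : Continuous f) {B : ℝ}
    (hB : ∀ x, |f x| ≤ B) : Integrable fun x => f x * ρ x :=
  hρ.bdd_mul hf.aestronglyMeasurable (Eventually.of_forall hB)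

lemma integrable_inner_bdd {f q : Space N → Space N} (hq : Integrable q) (hf : Continuous f)
    {B : ℝ} (hB : ∀ x, ‖f x‖ ≤ B) : Integrable fun x => inner ℝ (f x) (q x) := by
  refine (hq.norm.const_mul B).mono (hf.aestronglyMeasurable.inner hq.1)
    (Eventually.of_forall fun x => ?_)
  have hB0 : 0 ≤ B := (norm_nonneg _).trans (hB 0)
  rw [Real.norm_eq_abs, Real.norm_of_nonneg (by positivity)]
  refine (abs_real_inner_le_norm _ _).trans ?_
  gcongr
  exact hB x

lemma sum_integral_normSq_weakGrad_recentred {A : Space N → Space N} {ε B : ℝ}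
    {u : Fin m → Space N → ℂ} (hu : ∀ j, MemH1 (u j)) (hA : Continuous A) (hB : ∀ x, ‖A x‖ ≤ B)
    (X Ξ : Space N) :
    ∑ j, ∫ x, ‖weakGrad (recentred A ε u X Ξ j) x‖ ^ 2
      = ∑ j, (∫ x, ‖magGrad A ε (u j) x‖ ^ 2)
        + (∫ x, ‖Ξ + A (ε • X) - A (ε • x)‖ ^ 2 * density u x)
        - 2 * ∫ x, inner ℝ (Ξ + A (ε • X) - A (ε • x)) (momentum A ε u x) := by
  set b := Ξ + A (ε • X)
  have hc : Continuous fun x => b - A (ε • x) := by fun_prop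
  have hcB : ∀ x, ‖b - A (ε • x)‖ ≤ ‖b‖ + B := fun x =>
    (norm_sub_le _ _).trans (by gcongr; exact hB _)
  have h2 : ∀ j, Integrable fun x => ‖b - A (ε • x)‖ ^ 2 * ‖u j x‖ ^ 2 := fun j =>
    integrable_bdd_mul (B := (‖b‖ + B) ^ 2) (integrable_normSq (hu j).1) (by fun_prop) fun x => by
      rw [abs_of_nonneg (by positivity)]
      gcongr
      exact hcB x
  have h3 : ∀ j, Integrable fun x => inner ℝ (b - A (ε • x)) (current A ε (u j) x) := fun j =>
    integrable_inner_bdd ((hu j).integrable_current hA hB) hc hcB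
  have e2 : ∫ x, ‖b - A (ε • x)‖ ^ 2 * density u x
      = ∑ j, ∫ x, ‖b - A (ε • x)‖ ^ 2 * ‖u j x‖ ^ 2 := by
    rw [← integral_finsetSum _ fun j _ => h2 j]
    simp only [density, Finset.mul_sum]
  have e3 : ∫ x, inner ℝ (b - A (ε • x)) (momentum A ε u x)
      = ∑ j, ∫ x, inner ℝ (b - A (ε • x)) (current A ε (u j) x) := by
    rw [← integral_finsetSum _ fun j _ => h3 j]
    simp only [momentum_eq_sum, inner_sum]
  rw [e2, e3, Finset.mul_sum, ← Finset.sum_add_distrib, ← Finset.sum_sub_distrib]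
  refine Finset.sum_congr rfl fun j _ => ?_
  have h1 := integrable_normSq ((hu j).memLp_magGrad (ε := ε) hA hB)
  rw [integral_normSq_weakGrad_recentred (hu j)]
  simp only [normSq_sub_smul_imVec A ε (u j)]
  have h12 : Integrable fun x => ‖magGrad A ε (u j) x‖ ^ 2 + ‖b - A (ε • x)‖ ^ 2 * ‖u j x‖ ^ 2 :=
    h1.add (h2 j)
  rw [integral_sub h12 ((h3 j).const_mul 2), integral_add h1 (h2 j), integral_const_mul]

/-- The nonlocal part of the total energy, with the opposite sign. -/
def nonlocalEnergy (K : Couplings m) (P : Potentials N) (ε : ℝ) (u : Fin m → Space N → ℂ) : ℝ :=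
  (1 / 2) * ∑ j, K.β j * (∫ x, ∫ y, P.Φ (ε • (x - y)) * ‖u j x‖ ^ 2 * ‖u j y‖ ^ 2)
  + (1 / 2) * ∑ j, ∑ i ∈ Finset.univ.erase j,
      K.w i j * (∫ x, ∫ y, P.Φ (ε • (x - y)) * ‖u i x‖ ^ 2 * ‖u j y‖ ^ 2)

/-- The local nonlinear terms depend only on moduli and are translation invariant, so they cancel.
Apart from the nonlocal energy, what remains besides `totalEnergy` is linear in the density and the
momentum, the quantities that `omega` controls. -/
lemma energy_recentred (K : Couplings m) (P : Potentials N) {ε BA BV : ℝ}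
    {u : Fin m → Space N → ℂ} (hu : ∀ j, MemH1 (u j)) (hA : C3Bound P.A BA) (hV : C3Bound P.V BV)
    (X Ξ : Space N) :
    energy K (recentred P.A ε u X Ξ) = totalEnergy K P ε u - (∫ x, P.V (ε • x) * density u x)
      + nonlocalEnergy K P ε u
      + (1 / 2) * (∫ x, ‖Ξ + P.A (ε • X) - P.A (ε • x)‖ ^ 2 * density u x)
      - ∫ x, inner ℝ (Ξ + P.A (ε • X) - P.A (ε • x)) (momentum P.A ε u x) := by
  have hVs : ∫ x, P.V (ε • x) * density u x = ∑ j, ∫ x, P.V (ε • x) * ‖u j x‖ ^ 2 := by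
    rw [← integral_finsetSum _ fun j _ => integrable_bdd_mul (B := BV)
      (integrable_normSq (hu j).1) (f := fun x => P.V (ε • x))
      (hV.continuous.comp (continuous_const_smul ε)) fun x => hV.norm_le _]
    simp only [density, Finset.mul_sum]
  have h1 : ∀ j, ∫ x, ‖recentred P.A ε u X Ξ j x‖ ^ (2 * K.p + 2)
      = ∫ x, ‖u j x‖ ^ (2 * K.p + 2) := fun j => by
    simp only [norm_recentred]
    exact integral_add_right_eq_self (fun x => ‖u j x‖ ^ (2 * K.p + 2)) X
  have h2 : ∀ i j, ∫ x, ‖recentred P.A ε u X Ξ i x‖ ^ (K.p + 1)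
        * ‖recentred P.A ε u X Ξ j x‖ ^ (K.p + 1)
      = ∫ x, ‖u i x‖ ^ (K.p + 1) * ‖u j x‖ ^ (K.p + 1) := fun i j => by
    simp only [norm_recentred]
    exact integral_add_right_eq_self (fun x => ‖u i x‖ ^ (K.p + 1) * ‖u j x‖ ^ (K.p + 1)) X
  have e1 : ∑ j, K.α j / (K.p + 1) * (∫ x, ‖u j x‖ ^ (2 * K.p + 2))
      = 1 / (K.p + 1) * ∑ j, K.α j * (∫ x, ‖u j x‖ ^ (2 * K.p + 2)) := by
    rw [Finset.mul_sum]
    exact Finset.sum_congr rfl fun j _ => by ring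
  have e2 : ∑ j, ∑ i ∈ Finset.univ.erase j,
        K.γ i j / (K.p + 1) * (∫ x, ‖u i x‖ ^ (K.p + 1) * ‖u j x‖ ^ (K.p + 1))
      = 1 / (K.p + 1) * ∑ j, ∑ i ∈ Finset.univ.erase j,
        K.γ i j * (∫ x, ‖u i x‖ ^ (K.p + 1) * ‖u j x‖ ^ (K.p + 1)) := by
    simp only [Finset.mul_sum]
    exact Finset.sum_congr rfl fun j _ => Finset.sum_congr rfl fun i _ => by ring
  rw [energy, sum_integral_normSq_weakGrad_recentred hu hA.continuous hA.norm_le, totalEnergy,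
    nonlocalEnergy, hVs]
  simp only [h1, h2, e1, e2]
  ring

lemma energy_congr (K : Couplings m) {u v : Fin m → Space N → ℂ} (hu : ∀ j, MemH1 (u j))
    (h : ∀ j, u j =ᵐ[volume] v j) : energy K u = energy K v := by
  have h0 : ∀ j, ∫ x, ‖weakGrad (u j) x‖ ^ 2 = ∫ x, ‖weakGrad (v j) x‖ ^ 2 := fun j => by
    refine integral_congr_ae ?_
    filter_upwards [weakGrad_congr ⟨_, (hu j).hasWeakGrad⟩ (h j)] with x hx using by rw [hx]
  have h1 : ∀ j, ∫ x, ‖u j x‖ ^ (2 * K.p + 2) = ∫ x, ‖v j x‖ ^ (2 * K.p + 2) := fun j => by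
    refine integral_congr_ae ?_
    filter_upwards [h j] with x hx using by rw [hx]
  have h2 : ∀ i j, ∫ x, ‖u i x‖ ^ (K.p + 1) * ‖u j x‖ ^ (K.p + 1)
      = ∫ x, ‖v i x‖ ^ (K.p + 1) * ‖v j x‖ ^ (K.p + 1) := fun i j => by
    refine integral_congr_ae ?_
    filter_upwards [h i, h j] with x hi hj using by rw [hi, hj]
  simp only [energy, h0, h1, h2]

lemma totalMass_recentred (A : Space N → Space N) (ε : ℝ) (u : Fin m → Space N → ℂ)
    (X Ξ : Space N) : totalMass (recentred A ε u X Ξ) = totalMass u := by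
  simp only [totalMass, mass, norm_recentred]
  exact Finset.sum_congr rfl fun j _ => integral_add_right_eq_self (fun x => ‖u j x‖ ^ 2) X

/-! ### The quantities controlled by `Ω` -/

lemma C3Bound.comp_sub_const {F : Type*} [NormedAddCommGroup F] [NormedSpace ℝ F]
    {f : Space N → F} {B : ℝ} (hf : C3Bound f B) (w : Space N) :
    C3Bound (fun z => f (z - w)) B := by
  refine ⟨hf.contDiff.comp (contDiff_id.sub contDiff_const), fun n hn x => ?_⟩
  rw [iteratedFDeriv_comp_sub]
  exact hf.bound n hn _

lemma C3Bound.const_mul {f : Space N → ℝ} {B : ℝ} (hf : C3Bound f B) {a : ℝ} (ha : 0 ≤ a) :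
    C3Bound (fun z => a * f z) (a * B) := by
  refine ⟨contDiff_const.mul hf.contDiff, fun n hn x => ?_⟩
  have hn' : (n : WithTop ℕ∞) ≤ 3 := by exact_mod_cast hn
  have h := iteratedFDeriv_const_smul_apply (𝕜 := ℝ) (i := n) (a := a) (f := f) (x := x)
    (hf.contDiff.contDiffAt.of_le hn')
  change ‖iteratedFDeriv ℝ n (a • f) x‖ ≤ _
  rw [h, norm_smul, Real.norm_of_nonneg ha]
  gcongr
  exact hf.bound n hn x

lemma density_nonneg (u : Fin m → Space N → ℂ) (x : Space N) : 0 ≤ density u x :=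
  Finset.sum_nonneg fun _ _ => by positivity

lemma integral_density {u : Fin m → Space N → ℂ} (hu : ∀ j, MemH1 (u j)) :
    ∫ x, density u x = totalMass u := by
  simp only [density, totalMass, mass]
  exact integral_finsetSum _ fun j _ => integrable_normSq (hu j).1

section

variable {A : Space N → Space N} {χ : Space N → ℝ} {ε M : ℝ} {u : Fin m → Space N → ℂ}
  {X Ξ : Space N}

lemma sSup_densityDefect_nonneg : 0 ≤ sSup {d : ℝ | ∃ φ : Space N → ℝ, ContDiff ℝ 3 φ ∧
    ckNorm 3 φ ≤ 1 ∧ d = |densityDefect ε M u X φ|} :=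
  Real.sSup_nonneg fun _ ⟨_, _, _, hd⟩ => hd ▸ abs_nonneg _

lemma norm_momentum_sub_le_omega :
    ‖(∫ x, momentum A ε u x) - M • Ξ‖ ≤ omega A χ ε M u X Ξ := by
  have h1 := sSup_densityDefect_nonneg (ε := ε) (M := M) (u := u) (X := X)
  have h2 := norm_nonneg (M • (ε • X) - ∫ x, (χ (ε • x) * density u x) • (ε • x))
  have h3 : 0 ≤ rhoA A ε M u X Ξ := abs_nonneg _
  rw [omega, omegaHat]
  linarith

lemma omega_nonneg : 0 ≤ omega A χ ε M u X Ξ :=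
  (norm_nonneg _).trans norm_momentum_sub_le_omega

lemma rhoA_le_omega : rhoA A ε M u X Ξ ≤ omega A χ ε M u X Ξ := by
  have h1 := sSup_densityDefect_nonneg (ε := ε) (M := M) (u := u) (X := X)
  have h2 := norm_nonneg (M • (ε • X) - ∫ x, (χ (ε • x) * density u x) • (ε • x))
  have h3 := norm_nonneg ((∫ x, momentum A ε u x) - M • Ξ)
  rw [omega, omegaHat]
  linarith

lemma abs_densityDefect_le_omega (hu : ∀ j, MemH1 (u j)) {f : Space N → ℝ}
    (hf : ContDiff ℝ 3 f) (hf1 : ckNorm 3 f ≤ 1) :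
    |densityDefect ε M u X f| ≤ omega A χ ε M u X Ξ := by
  -- A real `sSup` of an unbounded set is `0` and would control nothing. Here `|φ| ≤ 1` because the
  -- order zero term of `ckNorm` is at most `1`.
  have hbdd : BddAbove {d : ℝ | ∃ φ : Space N → ℝ, ContDiff ℝ 3 φ ∧
      ckNorm 3 φ ≤ 1 ∧ d = |densityDefect ε M u X φ|} := by
    refine ⟨(∫ x, density u x) + |M|, ?_⟩
    rintro d ⟨φ, hφ, hφ1, rfl⟩
    have hb : ∀ x, |φ x| ≤ 1 := fun x => by
      have h := norm_iteratedFDeriv_le_ckNorm (hφ1.trans_lt ENNReal.one_lt_top)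
        (n := 0) (by norm_num) (s := Fin.elim0) (fun i => i.elim0) x
      rw [iteratedFDeriv_zero_apply] at h
      exact h.trans (by simpa using ENNReal.toReal_mono ENNReal.one_ne_top hφ1)
    have hd := integrable_density hu
    rw [densityDefect]
    refine (abs_sub _ _).trans (add_le_add ?_ ?_)
    · refine abs_integral_le_integral_abs.trans (integral_mono_of_nonneg
        (Eventually.of_forall fun x => abs_nonneg _) hd (Eventually.of_forall fun x => ?_))
      simp only [abs_mul, abs_of_nonneg (density_nonneg u x)]
      exact mul_le_of_le_one_left (density_nonneg u x) (hb _)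
    · rw [abs_mul]
      exact mul_le_of_le_one_right (abs_nonneg _) (hb _)
  have h1 := le_csSup hbdd ⟨f, hf, hf1, rfl⟩
  have h2 := norm_nonneg (M • (ε • X) - ∫ x, (χ (ε • x) * density u x) • (ε • x))
  have h3 := norm_nonneg ((∫ x, momentum A ε u x) - M • Ξ)
  have h4 : 0 ≤ rhoA A ε M u X Ξ := abs_nonneg _
  rw [omega, omegaHat]
  linarith

lemma C3Bound.abs_densityDefect_le {f : Space N → ℝ} {B : ℝ} (hf : C3Bound f B)
    (hu : ∀ j, MemH1 (u j)) :
    |densityDefect ε M u X f| ≤ ckConst N * (B + 1) * omega A χ ε M u X Ξ := by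
  have hB := hf.nonneg
  -- The function is rescaled into the unit ball of `C^3`; using `B + 1` instead of `B` keeps the
  -- divisor positive when `B = 0`.
  have hD : 0 < ckConst N * (B + 1) := mul_pos (ckConst_pos N) (by linarith)
  set D := ckConst N * (B + 1) with hDdef
  have hg := hf.const_mul (inv_nonneg.2 hD.le)
  have hg1 : ckNorm 3 (fun z => D⁻¹ * f z) ≤ 1 := by
    refine hg.ckNorm_le.trans ?_
    rw [← ENNReal.ofReal_one]
    refine ENNReal.ofReal_le_ofReal ?_
    rw [mul_left_comm, inv_mul_le_iff₀ hD, hDdef]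
    nlinarith [ckConst_pos N]
  have h := abs_densityDefect_le_omega (A := A) (χ := χ) (ε := ε) (M := M) (X := X) (Ξ := Ξ)
    hu hg.contDiff hg1
  have e : densityDefect ε M u X (fun z => D⁻¹ * f z) = D⁻¹ * densityDefect ε M u X f := by
    simp only [densityDefect, mul_assoc, integral_const_mul]
    ring
  rwa [e, abs_mul, abs_of_pos (inv_pos.2 hD), inv_mul_le_iff₀ hD] at h

end

/-! ### Even weights -/

/-- A nonnegative even weight with finite second moment. -/
structure EvenWeight (ρ : Space N → ℝ) : Prop where
  nonneg : ∀ x, 0 ≤ ρ x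
  integrable : Integrable ρ
  moment : Integrable fun x => ‖x‖ ^ 2 * ρ x
  even : ∀ x, ρ (-x) = ρ x

lemma EvenWeight.moment_nonneg {ρ : Space N → ℝ} (hρ : EvenWeight ρ) :
    0 ≤ ∫ x, ‖x‖ ^ 2 * ρ x :=
  integral_nonneg fun x => mul_nonneg (by positivity) (hρ.nonneg x)

lemma EvenWeight.sum {ρ : Fin m → Space N → ℝ} (hρ : ∀ j, EvenWeight (ρ j)) :
    EvenWeight fun x => ∑ j, ρ j x where
  nonneg x := Finset.sum_nonneg fun j _ => (hρ j).nonneg x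
  integrable := integrable_finsetSum _ fun j _ => (hρ j).integrable
  moment := by
    simp only [Finset.mul_sum]
    exact integrable_finsetSum _ fun j _ => (hρ j).moment
  even x := Finset.sum_congr rfl fun j _ => (hρ j).even x

/-- Averaging a `C^3` function against an even weight at scale `ε` costs only `O(ε^2)`. -/
lemma EvenWeight.abs_integral_sub_le {ρ : Space N → ℝ} (hρ : EvenWeight ρ) {f : Space N → ℝ}
    {B : ℝ} (hf : C3Bound f B) (z : Space N) (ε : ℝ) :
    |(∫ x, f (z + ε • x) * ρ x) - f z * ∫ x, ρ x| ≤ B * ε ^ 2 * ∫ x, ‖x‖ ^ 2 * ρ x := by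
  set L := fderiv ℝ f z with hL
  have i1 : Integrable fun x => f (z + ε • x) * ρ x :=
    integrable_bdd_mul (f := fun x => f (z + ε • x)) hρ.integrable
      (hf.continuous.comp (by fun_prop)) (fun x => hf.norm_le _)
  have i2 : Integrable fun x => f z * ρ x := hρ.integrable.const_mul _
  have i3 : Integrable fun x => L (ε • x) * ρ x := by
    refine ((hρ.integrable.add hρ.moment).const_mul (‖L‖ * |ε|)).mono
      ((L.continuous.comp (continuous_const_smul ε)).aestronglyMeasurable.mul hρ.integrable.1)
      (Eventually.of_forall fun x => ?_)
    have h0 := hρ.nonneg x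
    have h1 : ‖L (ε • x)‖ ≤ ‖L‖ * |ε| * ‖x‖ := by
      refine (L.le_opNorm _).trans (le_of_eq ?_)
      rw [norm_smul, Real.norm_eq_abs, mul_assoc]
    have h2 : ‖x‖ ≤ 1 + ‖x‖ ^ 2 := by nlinarith [sq_nonneg (‖x‖ - 1)]
    rw [norm_mul, Real.norm_of_nonneg h0, Pi.add_apply,
      Real.norm_of_nonneg (mul_nonneg (by positivity) (by positivity))]
    calc ‖L (ε • x)‖ * ρ x ≤ (‖L‖ * |ε| * (1 + ‖x‖ ^ 2)) * ρ x := by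
          gcongr
          exact h1.trans (by gcongr)
      _ = _ := by ring
  -- The linear Taylor term is odd and the weight is even. This cancellation is what turns an error
  -- `O(ε)` into `O(ε^2)`.
  have hodd : ∫ x, L (ε • x) * ρ x = 0 := by
    have h := integral_neg_eq_self (fun x => L (ε • x) * ρ x) volume
    simp only [hρ.even, smul_neg, map_neg, neg_mul, integral_neg] at h
    linarith
  have e : (∫ x, f (z + ε • x) * ρ x) - f z * ∫ x, ρ x
      = ∫ x, (f (z + ε • x) - f z - L (ε • x)) * ρ x := by
    have i12 : Integrable fun x => f (z + ε • x) * ρ x - f z * ρ x := i1.sub i2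
    simp only [sub_mul]
    rw [integral_sub i12 i3, integral_sub i1 i2, hodd, integral_const_mul, sub_zero]
  rw [e, ← integral_const_mul]
  refine abs_integral_le_integral_abs.trans (integral_mono_of_nonneg
    (Eventually.of_forall fun x => abs_nonneg _) (hρ.moment.const_mul _)
    (Eventually.of_forall fun x => ?_))
  have h := hf.taylor z (ε • x)
  simp only [abs_mul, abs_of_nonneg (hρ.nonneg x)]
  calc |f (z + ε • x) - f z - L (ε • x)| * ρ x ≤ (B * ‖ε • x‖ ^ 2) * ρ x := by
        gcongr
        exact hρ.nonneg x
    _ = B * ε ^ 2 * (‖x‖ ^ 2 * ρ x) := by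
        rw [norm_smul, mul_pow, Real.norm_eq_abs, sq_abs]; ring

/-! ### Nonlocal interaction integrals -/

lemma interaction_le {Φ : Space N → ℝ} (hΦ : ∀ z, 0 ≤ Φ z) {ε : ℝ} {a b H : Space N → ℝ}
    (ha : ∀ x, 0 ≤ a x) (hb : ∀ x, 0 ≤ b x)
    (hH : ∀ x, ∫ y, Φ (ε • (x - y)) * b y ≤ H x) (hHa : Integrable fun x => H x * a x) :
    ∫ x, ∫ y, Φ (ε • (x - y)) * a x * b y ≤ ∫ x, H x * a x := by
  refine integral_mono_of_nonneg (Eventually.of_forall fun x => integral_nonneg fun y =>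
    mul_nonneg (mul_nonneg (hΦ _) (ha x)) (hb y)) hHa (Eventually.of_forall fun x => ?_)
  have e : ∀ y, Φ (ε • (x - y)) * a x * b y = a x * (Φ (ε • (x - y)) * b y) := fun y => by ring
  simp only [e, integral_const_mul]
  rw [mul_comm]
  gcongr
  · exact ha x
  · exact hH x

/-- `EvenWeight.abs_integral_sub_le` applied twice: in `y` with centre `εx` and scale `-ε`, which
replaces the convolution by `Φ(εx) ∫ b`, then in `x` with centre `0`. Each average contributes one
of the two second moment terms. -/
lemma le_interaction {Φ : Space N → ℝ} {B : ℝ} (hΦ : C3Bound Φ B) (ε : ℝ) {a b : Space N → ℝ}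
    (ha : EvenWeight a) (hb : EvenWeight b) :
    Φ 0 * (∫ x, a x) * (∫ x, b x) - B * ε ^ 2 *
        ((∫ x, ‖x‖ ^ 2 * a x) * (∫ x, b x) + (∫ x, a x) * ∫ x, ‖x‖ ^ 2 * b x)
      ≤ ∫ x, ∫ y, Φ (ε • (x - y)) * a x * b y := by
  set ma := ∫ x, a x
  set mb := ∫ x, b x with hmb
  set Jb := ∫ x, ‖x‖ ^ 2 * b x
  have hmb0 : 0 ≤ mb := integral_nonneg hb.nonneg
  set G : Space N → ℝ := fun z => ∫ y, Φ (z + (-ε) • y) * b y with hG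
  have hGc : Continuous G := by
    refine continuous_of_dominated (bound := fun y => B * b y) (fun z => ?_)
      (fun z => Eventually.of_forall fun y => ?_) (hb.integrable.const_mul B)
      (Eventually.of_forall fun y => ?_)
    · exact ((hΦ.continuous.comp (by fun_prop)).aestronglyMeasurable).mul hb.integrable.1
    · rw [norm_mul, Real.norm_of_nonneg (hb.nonneg y)]
      exact mul_le_mul_of_nonneg_right (hΦ.norm_le _) (hb.nonneg y)
    · exact (hΦ.continuous.comp (by fun_prop)).mul continuous_const
  have hGb : ∀ z, |G z - Φ z * mb| ≤ B * ε ^ 2 * Jb := fun z => by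
    have h := hb.abs_integral_sub_le hΦ z (-ε)
    rwa [neg_sq] at h
  have hGn : ∀ z, |G z| ≤ B * mb + B * ε ^ 2 * Jb := fun z => by
    have h1 := hGb z
    have h2 : |Φ z * mb| ≤ B * mb := by
      rw [abs_mul, abs_of_nonneg hmb0]
      exact mul_le_mul_of_nonneg_right (hΦ.norm_le z) hmb0
    have h3 := abs_add_le (G z - Φ z * mb) (Φ z * mb)
    rw [sub_add_cancel] at h3
    linarith
  have e : ∀ x, ∫ y, Φ (ε • (x - y)) * a x * b y = G (ε • x) * a x := fun x => by
    have e' : ∀ y, Φ (ε • (x - y)) * a x * b y = Φ (ε • x + (-ε) • y) * b y * a x := fun y => by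
      rw [smul_sub, neg_smul, ← sub_eq_add_neg]; ring
    simp only [e', integral_mul_const, hG]
  simp only [e]
  have iΦ : Integrable fun x => Φ (ε • x) * a x :=
    integrable_bdd_mul (f := fun x => Φ (ε • x)) ha.integrable
      (hΦ.continuous.comp (continuous_const_smul ε)) (fun x => hΦ.norm_le _)
  have iG : Integrable fun x => G (ε • x) * a x :=
    integrable_bdd_mul (f := fun x => G (ε • x)) ha.integrable
      (hGc.comp (continuous_const_smul ε)) (fun x => hGn _)
  have h1 : ∫ x, (mb * (Φ (ε • x) * a x) - B * ε ^ 2 * Jb * a x) ≤ ∫ x, G (ε • x) * a x := by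
    refine integral_mono ((iΦ.const_mul mb).sub (ha.integrable.const_mul _)) iG fun x => ?_
    have := (abs_le.1 (hGb (ε • x))).1
    have h0 := ha.nonneg x
    simp only
    nlinarith
  rw [integral_sub (iΦ.const_mul mb) (ha.integrable.const_mul _), integral_const_mul,
    integral_const_mul] at h1
  have h2 := (abs_le.1 (ha.abs_integral_sub_le hΦ 0 ε)).1
  simp only [zero_add] at h2
  refine le_trans ?_ h1
  have h3 := mul_le_mul_of_nonneg_left h2 hmb0
  linarith

/-! ### The classical Hamiltonian -/

lemma inner_crossB (A : Space N → Space N) (v z : Space N) : inner ℝ v (crossB A v z) = 0 := by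
  have h : inner ℝ v (crossB A v z) = ∑ l, ∑ i, v l * v i *
      (fderiv ℝ A z (stdVec i) l - fderiv ℝ A z (stdVec l) i) := by
    simp only [PiLp.inner_apply, crossB, RCLike.inner_apply, conj_trivial, Finset.sum_mul]
    exact Finset.sum_congr rfl fun l _ => Finset.sum_congr rfl fun i _ => by ring
  have h' : inner ℝ v (crossB A v z) = -inner ℝ v (crossB A v z) := by
    conv_lhs => rw [h, Finset.sum_comm]
    rw [h, ← Finset.sum_neg_distrib]
    refine Finset.sum_congr rfl fun l _ => ?_
    rw [← Finset.sum_neg_distrib]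
    exact Finset.sum_congr rfl fun i _ => by ring
  linarith

/-- The magnetic force does no work (`inner_crossB`, by antisymmetry of the field), and the work of
the electric force cancels the change of `V(εx)`. -/
lemma IsTrajectory.hamiltonian_eq {P : Potentials N} {ε BV : ℝ} (hV : C3Bound P.V BV)
    {x₀ ξ₀ : Space N} {x ξ : ℝ → Space N} (h : IsTrajectory P ε x₀ ξ₀ x ξ) {t : ℝ} (ht : 0 ≤ t) :
    (1 / 2) * ‖ξ t‖ ^ 2 + P.V (ε • x t) = (1 / 2) * ‖ξ 0‖ ^ 2 + P.V (ε • x 0) := by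
  have hd : ∀ s, 0 ≤ s → HasDerivWithinAt (fun t => (1 / 2) * ‖ξ t‖ ^ 2 + P.V (ε • x t)) 0
      (Ici 0) s := fun s hs => by
    have hVd : DifferentiableAt ℝ P.V (ε • x s) :=
      hV.contDiff.differentiable (by norm_num) _
    have h1 := ((h.ξ_deriv s hs).norm_sq).const_mul (1 / 2 : ℝ)
    have h2 := hVd.hasFDerivAt.comp_hasDerivWithinAt s ((h.x_deriv s hs).const_smul ε)
    refine (h1.add h2).congr_deriv ?_
    rw [inner_sub_right, inner_neg_right, real_inner_smul_right, real_inner_smul_right,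
      inner_crossB, real_inner_comm, inner_gradient_left, map_smul, smul_eq_mul]
    ring
  refine constant_of_has_deriv_right_zero (a := 0) (b := t)
    (fun s hs => ((hd s hs.1).continuousWithinAt).mono Icc_subset_Ici_self)
    (fun s hs => (hd s hs.1).mono (Ici_subset_Ici.2 hs.1)) t ⟨ht, le_rfl⟩

/-! ### Comparison of the energies -/

lemma C3Bound.mono {F : Type*} [NormedAddCommGroup F] [NormedSpace ℝ F] {f : Space N → F}
    {B B' : ℝ} (hf : C3Bound f B) (h : B ≤ B') : C3Bound f B' :=
  ⟨hf.contDiff, fun n hn x => (hf.bound n hn x).trans h⟩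

/-- The quadratic form `½ ∑ β_j I_{jj} + ½ ∑_{i ≠ j} ω_{ij} I_{ij}`. -/
def couplingSum (K : Couplings m) (I : Fin m → Fin m → ℝ) : ℝ :=
  (1 / 2) * ∑ j, K.β j * I j j
  + (1 / 2) * ∑ j, ∑ i ∈ Finset.univ.erase j, K.w i j * I i j

lemma couplingSum_mono (K : Couplings m) {I J : Fin m → Fin m → ℝ} (h : ∀ i j, I i j ≤ J i j) :
    couplingSum K I ≤ couplingSum K J := by
  unfold couplingSum
  gcongr with j _ j _ i _
  · exact K.β_nonneg j
  · exact h j j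
  · exact K.w_nonneg i j
  · exact h i j

lemma couplingSum_add_smul (K : Couplings m) (I J : Fin m → Fin m → ℝ) (a : ℝ) :
    couplingSum K (fun i j => I i j + a * J i j) = couplingSum K I + a * couplingSum K J := by
  have h1 : ∀ j, K.β j * (I j j + a * J j j) = K.β j * I j j + a * (K.β j * J j j) :=
    fun j => by ring
  have h2 : ∀ i j, K.w i j * (I i j + a * J i j) = K.w i j * I i j + a * (K.w i j * J i j) :=
    fun i j => by ring
  simp only [couplingSum, h1, h2, Finset.sum_add_distrib, ← Finset.mul_sum]
  ring

lemma nonlocalEnergy_eq (K : Couplings m) (P : Potentials N) (ε : ℝ) (u : Fin m → Space N → ℂ) :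
    nonlocalEnergy K P ε u = couplingSum K fun i j =>
      ∫ x, ∫ y, P.Φ (ε • (x - y)) * ‖u i x‖ ^ 2 * ‖u j y‖ ^ 2 := rfl

lemma totalMass_nonneg (u : Fin m → Space N → ℂ) : 0 ≤ totalMass u :=
  Finset.sum_nonneg fun _ _ => integral_nonneg fun _ => by positivity

/-- `Ω` sees only the total density, not each component. With several components the bound therefore
comes from `Φ ≤ Φ(0)` alone. With one component the density defect is used twice, for `z ↦ Φ(εx -
z)` in the inner integral and for `z ↦ Φ(z - εX)` in the outer one; each use costs `M` times the
defect bound, whence the factor `2`. -/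
lemma interaction_le_omega {Φ : Space N → ℝ} {B : ℝ} (hΦ : C3Bound Φ B) (hΦ0 : ∀ z, 0 ≤ Φ z)
    (hmax : 1 < m → ∀ z, Φ z ≤ Φ 0) {A : Space N → Space N} {χ : Space N → ℝ} {ε : ℝ}
    {u : Fin m → Space N → ℂ} {X Ξ : Space N} (hu : ∀ j, MemH1 (u j)) (i j : Fin m) :
    ∫ x, ∫ y, Φ (ε • (x - y)) * ‖u i x‖ ^ 2 * ‖u j y‖ ^ 2 ≤ Φ 0 * mass u i * mass u j
      + 2 * totalMass u * (ckConst N * (B + 1)) * omega A χ ε (totalMass u) u X Ξ := by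
  set Ω := omega A χ ε (totalMass u) u X Ξ
  set D := ckConst N * (B + 1)
  have hD : 0 ≤ D := mul_nonneg (ckConst_pos N).le (by linarith [hΦ.nonneg])
  have hΩ : 0 ≤ Ω := omega_nonneg
  have hM := totalMass_nonneg u
  have hi : ∀ j, Integrable fun x => ‖u j x‖ ^ 2 := fun j => integrable_normSq (hu j).1
  by_cases hm : 1 < m
  · have h := interaction_le hΦ0 (ε := ε) (a := fun x => ‖u i x‖ ^ 2) (b := fun x => ‖u j x‖ ^ 2)
      (H := fun _ => Φ 0 * mass u j) (fun x => by positivity) (fun x => by positivity)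
      (fun x => by
        rw [mass, ← integral_const_mul]
        exact integral_mono_of_nonneg
          (Eventually.of_forall fun y => mul_nonneg (hΦ0 _) (by positivity)) ((hi j).const_mul _)
          (Eventually.of_forall fun y => mul_le_mul_of_nonneg_right (hmax hm _) (by positivity)))
      ((hi i).const_mul _)
    rw [integral_const_mul] at h
    have : 0 ≤ 2 * totalMass u * D * Ω := by positivity
    rw [mass, mass] at *
    linarith
  · obtain rfl : m = 1 := by have := i.pos; omega
    obtain rfl : i = 0 := Subsingleton.elim _ _
    obtain rfl : j = 0 := Subsingleton.elim _ _
    have hdens : ∀ x, ‖u 0 x‖ ^ 2 = density u x := fun x => by simp [density]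
    have hmass : mass u 0 = totalMass u := by simp [totalMass]
    have hdi := integrable_density hu
    simp only [hdens, hmass]
    set M := totalMass u
    have hdM : ∫ x, density u x = M := integral_density hu
    have iΦ : Integrable fun x => Φ (ε • x - ε • X) * density u x :=
      integrable_bdd_mul (f := fun x => Φ (ε • x - ε • X)) hdi
        (hΦ.continuous.comp (by fun_prop)) (fun x => hΦ.norm_le _)
    have iH : Integrable fun x => M * (Φ (ε • x - ε • X) * density u x) + D * Ω * density u x :=
      (iΦ.const_mul M).add (hdi.const_mul (D * Ω))
    have h := interaction_le hΦ0 (ε := ε) (a := density u) (b := density u)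
      (H := fun x => M * Φ (ε • x - ε • X) + D * Ω) (density_nonneg u) (density_nonneg u)
      (fun x => by
        have h := (abs_le.1 ((hΦ.comp_const_sub (ε • x)).abs_densityDefect_le (A := A) (χ := χ)
          (ε := ε) (M := M) (X := X) (Ξ := Ξ) hu)).2
        simp only [densityDefect, ← smul_sub] at h ⊢
        linarith)
      (iH.congr (Eventually.of_forall fun x => by simp only; ring))
    have e : ∫ x, (M * Φ (ε • x - ε • X) + D * Ω) * density u x
        = M * (∫ x, Φ (ε • x - ε • X) * density u x) + D * Ω * M := by
      simp only [add_mul, mul_assoc M]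
      rw [integral_add (iΦ.const_mul M) (hdi.const_mul (D * Ω)), integral_const_mul,
        integral_const_mul, hdM]
    have h2 := (abs_le.1 ((hΦ.comp_sub_const (ε • X)).abs_densityDefect_le (A := A) (χ := χ)
          (ε := ε) (M := M) (X := X) (Ξ := Ξ) hu)).2
    simp only [densityDefect, sub_self] at h2
    rw [e] at h
    nlinarith [mul_le_mul_of_nonneg_left h2 hM]

/-- Upper bound for the energy of the recentred function in terms of `Ω`. -/
lemma exists_energy_recentred_le (K : Couplings m) (P : Potentials N) {BA BV BΦ : ℝ}
    (hA : C3Bound P.A BA) (hV : C3Bound P.V BV) (hΦ : C3Bound P.Φ BΦ) (hΦ0 : ∀ z, 0 ≤ P.Φ z)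
    (hmax : 1 < m → ∀ z, P.Φ z ≤ P.Φ 0) (χ : Space N → ℝ) (R M : ℝ) :
    ∃ C, ∀ (ε : ℝ) (u : Fin m → Space N → ℂ) (X Ξ : Space N), (∀ j, MemH1 (u j)) →
      totalMass u = M → ‖Ξ + P.A (ε • X)‖ ≤ R →
      energy K (recentred P.A ε u X Ξ) ≤ totalEnergy K P ε u
        - M * ((1 / 2) * ‖Ξ‖ ^ 2 + P.V (ε • X))
        + couplingSum K (fun i j => P.Φ 0 * mass u i * mass u j)
        + C * omega P.A χ ε M u X Ξ := by
  -- The summands are the errors in `∫ V |u|²`, in the nonlocal energy, in `½ ∫ |b - A|² |u|²` and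
  -- in `∫ (b - A) · q`. The last one is `R + 1`: `R` for `b · ∫ q`, and `1` for `∫ A · q`, which is
  -- the reason for including `rhoA` in `omega`.
  refine ⟨ckConst N * (BV + 1) + 2 * M * (ckConst N * (BΦ + 1)) * couplingSum K (fun _ _ => 1)
    + (1 / 2) * (ckConst N * (8 * (R + BA) ^ 2 + 1)) + (R + 1), ?_⟩
  intro ε u X Ξ hu hM hR
  subst hM
  have hR0 : 0 ≤ R := (norm_nonneg _).trans hR
  have hBA := hA.nonneg
  set M := totalMass u
  set Ω := omega P.A χ ε M u X Ξ with hΩdef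
  have hΩ : 0 ≤ Ω := omega_nonneg
  set b := Ξ + P.A (ε • X) with hb
  have h1 := (abs_le.1 (hV.abs_densityDefect_le (A := P.A) (χ := χ)
          (ε := ε) (M := M) (X := X) (Ξ := Ξ) hu)).1
  have h2 : nonlocalEnergy K P ε u ≤ couplingSum K (fun i j => P.Φ 0 * mass u i * mass u j)
      + 2 * M * (ckConst N * (BΦ + 1)) * Ω * couplingSum K (fun _ _ => 1) := by
    rw [nonlocalEnergy_eq, ← couplingSum_add_smul]
    refine couplingSum_mono K fun i j => ?_
    rw [mul_one]
    exact interaction_le_omega hΦ hΦ0 hmax hu i j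
  have hf : C3Bound (fun z => ‖b - P.A z‖ ^ 2) (8 * (R + BA) ^ 2) :=
    (hA.const_sub b).normSq.mono (by gcongr)
  have h3 := (abs_le.1 (hf.abs_densityDefect_le (A := P.A) (χ := χ)
          (ε := ε) (M := M) (X := X) (Ξ := Ξ) hu)).2
  have hbX : b - P.A (ε • X) = Ξ := by rw [hb]; abel
  have hq := integrable_momentum (A := P.A) (ε := ε) hu hA.continuous hA.norm_le
  have h4 : ∫ x, inner ℝ (b - P.A (ε • x)) (momentum P.A ε u x)
      = inner ℝ b (∫ x, momentum P.A ε u x)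
        - ∫ x, inner ℝ (P.A (ε • x)) (momentum P.A ε u x) := by
    simp only [inner_sub_left]
    rw [integral_sub (integrable_inner_bdd hq continuous_const (B := ‖b‖) fun _ => le_rfl)
      (integrable_inner_bdd hq (f := fun x => P.A (ε • x))
        (hA.continuous.comp (continuous_const_smul ε)) (fun x => hA.norm_le _)),
      integral_inner hq]
  have h5 : |inner ℝ b ((∫ x, momentum P.A ε u x) - M • Ξ)| ≤ R * Ω := by
    refine (abs_real_inner_le_norm _ _).trans ?_
    gcongr
    exact norm_momentum_sub_le_omega
  have h6 : |(∫ x, inner ℝ (P.A (ε • x)) (momentum P.A ε u x)) - M * inner ℝ (P.A (ε • X)) Ξ| ≤ Ω :=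
    rhoA_le_omega
  have h5' := (abs_le.1 h5).1
  have h6' := (abs_le.1 h6).2
  have h7 : inner ℝ b (M • Ξ) = M * (‖Ξ‖ ^ 2 + inner ℝ (P.A (ε • X)) Ξ) := by
    rw [real_inner_smul_right, hb, inner_add_left, real_inner_self_eq_norm_sq]
  rw [inner_sub_right, h7] at h5'
  simp only [densityDefect, hbX] at h1 h3
  rw [energy_recentred K P hu hA hV, h4]
  linarith

/-! ### Density, momentum and interaction of the initial datum -/

section

variable {r : Fin m → Space N → ℝ}

lemma norm_cplx_sq (r : Fin m → Space N → ℝ) (j : Fin m) (x : Space N) :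
    ‖cplx r j x‖ ^ 2 = r j x ^ 2 := by
  simp [cplx]

lemma evenWeight_sq (hr : ∀ j, MemH1 (cplx r j)) (hrad : ∀ j x y, ‖x‖ = ‖y‖ → r j x = r j y)
    (hmom : ∀ j, ∀ i : Fin N, MemLp (fun x : Space N => x i * r j x) 2 volume) (j : Fin m) :
    EvenWeight fun x => r j x ^ 2 where
  nonneg x := sq_nonneg _
  integrable := by
    simpa only [norm_cplx_sq] using integrable_normSq (hr j).1
  moment := by
    have h : ∀ x : Space N, ‖x‖ ^ 2 * r j x ^ 2 = ∑ i, (x i * r j x) ^ 2 := fun x => by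
      rw [EuclideanSpace.norm_sq_eq, Finset.sum_mul]
      exact Finset.sum_congr rfl fun i _ => by rw [mul_pow, Real.norm_eq_abs, sq_abs]
    simp only [h]
    exact integrable_finsetSum _ fun i _ => (hmom j i).integrable_sq
  even x := by simp only [hrad j (-x) x (norm_neg x)]

lemma initialDatum_eq (A : Space N → Space N) (ε : ℝ) (r : Fin m → Space N → ℝ) (X Ξ : Space N)
    (j : Fin m) : initialDatum A ε r X Ξ j = fun x =>
      planeWave (Ξ + A (ε • X)) (-inner ℝ (A (ε • X)) X) x * cplx r j (x + -X) := by
  funext x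
  rw [initialDatum, planeWave, mul_comm, cplx, ← sub_eq_add_neg]
  congr 4
  rw [inner_sub_right, inner_add_left, real_inner_comm x Ξ]
  ring

variable {A : Space N → Space N} {ε : ℝ} {u : Fin m → Space N → ℂ} {X Ξ : Space N}

lemma recentred_ae_eq_of_initialDatum (h : ∀ j, u j =ᵐ[volume] initialDatum A ε r X Ξ j)
    (j : Fin m) : recentred A ε u X Ξ j =ᵐ[volume] cplx r j := by
  have h' := (measurePreserving_add_right volume X).quasiMeasurePreserving.ae_eq_comp (h j)
  filter_upwards [h'] with x hx
  simp only [Function.comp_apply] at hx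
  rw [recentred_eq]
  simp only [hx, initialDatum_eq, add_neg_cancel_right]
  rw [← mul_assoc, planeWave, planeWave, ← Complex.exp_add, ← mul_add, ← Complex.ofReal_add]
  have : inner ℝ (-(Ξ + A (ε • X))) x + -inner ℝ Ξ X
      + (inner ℝ (Ξ + A (ε • X)) (x + X) + -inner ℝ (A (ε • X)) X) = 0 := by
    simp only [inner_neg_left, inner_add_left, inner_add_right]
    ring
  rw [this]
  simp

lemma normSq_ae_eq_of_initialDatum (h : ∀ j, u j =ᵐ[volume] initialDatum A ε r X Ξ j)
    (j : Fin m) : (fun x => ‖u j x‖ ^ 2) =ᵐ[volume] fun x => r j (x - X) ^ 2 := by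
  filter_upwards [h j] with x hx
  rw [hx, initialDatum_eq]
  simp [norm_cplx_sq, sub_eq_add_neg]

/-- The real profile contributes no current, so the momentum is the density times the gradient of
the phase minus `A(εx)`. -/
lemma momentum_ae_eq_of_initialDatum (hr : ∀ j, MemH1 (cplx r j))
    (h : ∀ j, u j =ᵐ[volume] initialDatum A ε r X Ξ j) :
    momentum A ε u =ᵐ[volume] fun x => density u x • (Ξ + A (ε • X) - A (ε • x)) := by
  have key : ∀ j, ∀ᵐ x, current A ε (u j) x = ‖u j x‖ ^ 2 • (Ξ + A (ε • X) - A (ε • x)) :=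
    fun j => by
    have hg := (((hr j).hasWeakGrad.comp_add (-X)).planeWave_mul (Ξ + A (ε • X))
      (-inner ℝ (A (ε • X)) X))
    rw [← initialDatum_eq A ε r X Ξ j] at hg
    have him := (measurePreserving_add_right volume (-X)).quasiMeasurePreserving.ae
      (HasWeakGrad.im_eq_zero (hr j).hasWeakGrad)
    filter_upwards [(hg.congr (h j).symm).weakGrad_ae_eq, him, h j] with x hx hix hux
    have hw := norm_planeWave (Ξ + A (ε • X)) (-inner ℝ (A (ε • X)) X) x
    rw [initialDatum_eq] at hux
    set w := planeWave (Ξ + A (ε • X)) (-inner ℝ (A (ε • X)) X) x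
    have hww : conj w * w = 1 := by
      rw [mul_comm, Complex.mul_conj, Complex.normSq_eq_norm_sq, hw]; simp
    ext k
    simp only [current, PiLp.smul_apply, PiLp.sub_apply, PiLp.add_apply, smul_eq_mul]
    rw [hx, hux, norm_mul, hw, one_mul, norm_cplx_sq]
    have e : conj (w * cplx r j (x + -X)) * ((w • (weakGrad (cplx r j) (x + -X)
          + cplx r j (x + -X) • imVec (Ξ + A (ε • X)))) k
          - Complex.I * ((A (ε • x) k : ℝ) : ℂ) * (w * cplx r j (x + -X)))
        = ((r j (x + -X) : ℝ) : ℂ) * (weakGrad (cplx r j) (x + -X) k)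
          + Complex.I * ((r j (x + -X) ^ 2 * (Ξ k + A (ε • X) k - A (ε • x) k) : ℝ) : ℂ) := by
      simp only [cplx, map_mul, Complex.conj_ofReal, PiLp.smul_apply, PiLp.add_apply, imVec_apply,
        smul_eq_mul]
      push_cast
      linear_combination (((r j (x + -X) : ℝ) : ℂ) * (weakGrad (cplx r j) (x + -X) k)
        + Complex.I * ((r j (x + -X) : ℝ) : ℂ) ^ 2 * (Ξ k + A (ε • X) k - A (ε • x) k)) * hww
    have hk := hix k
    rw [e, Complex.add_im, Complex.im_ofReal_mul, hk, Complex.I_mul_im, Complex.ofReal_re]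
    ring
  filter_upwards [ae_all_iff.2 key] with x hx
  rw [momentum_eq_sum, density, Finset.sum_smul]
  exact Finset.sum_congr rfl fun j _ => hx j

lemma interaction_eq_of_initialDatum (Φ : Space N → ℝ)
    (h : ∀ j, u j =ᵐ[volume] initialDatum A ε r X Ξ j) (i j : Fin m) :
    ∫ x, ∫ y, Φ (ε • (x - y)) * ‖u i x‖ ^ 2 * ‖u j y‖ ^ 2
      = ∫ x, ∫ y, Φ (ε • (x - y)) * r i x ^ 2 * r j y ^ 2 := by
  rw [← integral_sub_right_eq_self (fun x => ∫ y, Φ (ε • (x - y)) * r i x ^ 2 * r j y ^ 2) X]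
  refine integral_congr_ae ?_
  filter_upwards [normSq_ae_eq_of_initialDatum h i] with x hx
  rw [← integral_sub_right_eq_self (fun y => Φ (ε • (x - X - y)) * r i (x - X) ^ 2 * r j y ^ 2) X]
  refine integral_congr_ae ?_
  filter_upwards [normSq_ae_eq_of_initialDatum h j] with y hy
  rw [hx, hy, sub_sub_sub_cancel_right]

end

/-- Lower bound for the energy of the ground state in terms of the energy of the initial datum. -/
lemma exists_le_energy_initialDatum (K : Couplings m) (P : Potentials N) {BA BV BΦ : ℝ}
    (hA : C3Bound P.A BA) (hV : C3Bound P.V BV) (hΦ : C3Bound P.Φ BΦ) {r : Fin m → Space N → ℝ}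
    (hr : ∀ j, MemH1 (cplx r j)) (hw : ∀ j, EvenWeight fun x => r j x ^ 2) (R : ℝ) :
    ∃ C, ∀ (ε : ℝ) (u : Fin m → Space N → ℂ) (X Ξ : Space N), (∀ j, MemH1 (u j)) →
      (∀ j, u j =ᵐ[volume] initialDatum P.A ε r X Ξ j) → ‖Ξ + P.A (ε • X)‖ ≤ R →
      totalEnergy K P ε u - totalMass (cplx r) * ((1 / 2) * ‖Ξ‖ ^ 2 + P.V (ε • X))
        + couplingSum K (fun i j => P.Φ 0 * mass (cplx r) i * mass (cplx r) j) - C * ε ^ 2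
        ≤ energy K (cplx r) := by
  set ρ : Space N → ℝ := fun x => ∑ j, r j x ^ 2 with hρdef
  have hρ : EvenWeight ρ := EvenWeight.sum hw
  set J := ∫ x, ‖x‖ ^ 2 * ρ x
  set Q : Fin m → Fin m → ℝ := fun i j =>
    (∫ x, ‖x‖ ^ 2 * r i x ^ 2) * (∫ x, r j x ^ 2) + (∫ x, r i x ^ 2) * ∫ x, ‖x‖ ^ 2 * r j x ^ 2
  refine ⟨BV * J + BΦ * couplingSum K Q + (1 / 2) * (8 * (R + BA) ^ 2 * J), ?_⟩
  intro ε u X Ξ hu hu0 hR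
  have hR0 : 0 ≤ R := (norm_nonneg _).trans hR
  have hBA := hA.nonneg
  set b := Ξ + P.A (ε • X) with hb
  have hbX : b - P.A (ε • X) = Ξ := by rw [hb]; abel
  have hmass : ∀ j, mass (cplx r) j = ∫ x, r j x ^ 2 := fun j => by
    simp only [mass, norm_cplx_sq]
  have hM : ∫ x, ρ x = totalMass (cplx r) := by
    simp only [hρdef, totalMass, hmass]
    exact integral_finsetSum _ fun j _ => (hw j).integrable
  have hE : energy K (recentred P.A ε u X Ξ) = energy K (cplx r) :=
    energy_congr K (fun j => memH1_recentred (hu j)) (recentred_ae_eq_of_initialDatum hu0)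
  have hdens : density u =ᵐ[volume] fun x => ρ (x - X) := by
    filter_upwards [ae_all_iff.2 fun j => normSq_ae_eq_of_initialDatum hu0 j] with x hx
    exact Finset.sum_congr rfl fun j _ => hx j
  have havg : ∀ f : Space N → ℝ,
      ∫ x, f (ε • x) * density u x = ∫ x, f (ε • X + ε • x) * ρ x := fun f => by
    rw [← integral_sub_right_eq_self (fun x => f (ε • X + ε • x) * ρ x) X]
    refine integral_congr_ae ?_
    filter_upwards [hdens] with x hx
    rw [hx, ← smul_add, add_sub_cancel]
  have hf : C3Bound (fun z => ‖b - P.A z‖ ^ 2) (8 * (R + BA) ^ 2) :=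
    (hA.const_sub b).normSq.mono (by gcongr)
  have h1 := (abs_le.1 (hρ.abs_integral_sub_le hV (ε • X) ε)).2
  have h2 := (abs_le.1 (hρ.abs_integral_sub_le hf (ε • X) ε)).2
  rw [← havg, hM] at h1
  rw [← havg (fun z => ‖b - P.A z‖ ^ 2), hM, hbX] at h2
  -- For the initial datum the momentum term is exactly twice the quadratic one, so together they
  -- give `-½ ∫ |b - A|² |u|²`, which is `-½ M |Ξ|²` up to `O(ε^2)`.
  have h3 : ∫ x, inner ℝ (b - P.A (ε • x)) (momentum P.A ε u x)
      = ∫ x, ‖b - P.A (ε • x)‖ ^ 2 * density u x := by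
    refine integral_congr_ae ?_
    filter_upwards [momentum_ae_eq_of_initialDatum hr hu0] with x hx
    rw [hx, real_inner_smul_right, real_inner_self_eq_norm_sq, mul_comm]
  have h4 : couplingSum K (fun i j => P.Φ 0 * mass (cplx r) i * mass (cplx r) j)
      + (-(BΦ * ε ^ 2)) * couplingSum K Q ≤ nonlocalEnergy K P ε u := by
    rw [nonlocalEnergy_eq, ← couplingSum_add_smul]
    refine couplingSum_mono K fun i j => ?_
    rw [interaction_eq_of_initialDatum P.Φ hu0, hmass, hmass]
    refine le_trans (le_of_eq ?_) (le_interaction hΦ ε (hw i) (hw j))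
    simp only [Q]
    ring
  rw [← hE, energy_recentred K P hu hA hV, h3]
  linarith

/-! ### Localization of the approximating profile -/

lemma planeWave_zero (θ : ℝ) (x : Space N) :
    planeWave 0 θ x = Complex.exp (Complex.I * (θ : ℂ)) := by
  simp [planeWave]

lemma MemH1.phase_translate {r : Fin m → Space N → ℝ} {j : Fin m} (hr : MemH1 (cplx r j)) (θ : ℝ)
    (y : Space N) : MemH1 fun x => Complex.exp (Complex.I * (θ : ℂ)) * (r j (x + y) : ℂ) := by
  have h := (hr.comp_add y).planeWave_mul 0 θ
  simp only [planeWave_zero] at h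
  exact h

lemma h1NormSq_phase_translate_le {r : Fin m → Space N → ℝ} {j : Fin m} (hr : MemH1 (cplx r j))
    (θ : ℝ) (y : Space N) :
    h1NormSq (fun x => Complex.exp (Complex.I * (θ : ℂ)) * (r j (x + y) : ℂ))
      ≤ 2 * h1NormSq (cplx r j) := by
  have h := h1NormSq_planeWave_mul_le (hr.comp_add y) 0 θ
  rw [h1NormSq_comp_add hr] at h
  simpa [planeWave_zero, cplx] using h

/-- If `Ω` is small, a translate of `r` that is close to the recentred function is not far from
the origin. -/
lemma norm_shift_le {A : Space N → Space N} {χ ζ : Space N → ℝ} {ε Bζ : ℝ}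
    {u : Fin m → Space N → ℂ} {X Ξ : Space N} {r : Fin m → Space N → ℝ} {M : ℝ}
    (hu : ∀ j, MemH1 (u j)) (hr : ∀ j, MemH1 (cplx r j))
    (hw : ∀ j, EvenWeight fun x => r j x ^ 2) (hM : 0 < M)
    (hζ : C3Bound ζ Bζ) (hζ0 : ζ 0 = 1) (hζn : ∀ x, 0 ≤ ζ x) (hζ1 : ∀ x, ζ x ≤ 1)
    (hζs : ∀ x, 1 ≤ ‖x‖ → ζ x = 0) (hε : 0 < ε)
    (hΩ : ckConst N * (Bζ + 1) * omega A χ ε M u X Ξ ≤ M / 4) {y : Space N} {θ : Fin m → ℝ}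
    (hd : ∑ j, h1NormSq (fun x => recentred A ε u X Ξ j x
      - Complex.exp (Complex.I * (θ j : ℂ)) * (r j (x + y) : ℂ)) ≤ M / 8) :
    ‖y‖ ≤ ε⁻¹ + 1 + 4 * (∫ x, ‖x‖ ^ 2 * ∑ j, r j x ^ 2) / M := by
  set J := ∫ x, ‖x‖ ^ 2 * ∑ j, r j x ^ 2 with hJ
  have hρ := EvenWeight.sum hw
  have hJ0 : 0 ≤ J := hρ.moment_nonneg
  -- The translate `r(· + y)` is centred at `-y`; `L` is the distance from this centre to the ball
  -- of radius `1/ε` when the centre lies outside it.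
  set L := ‖y‖ - ε⁻¹ with hL
  suffices L ≤ 1 + 4 * J / M by linarith
  rcases le_or_gt L 0 with hL0 | hL0
  · have : 0 ≤ 4 * J / M := by positivity
    linarith
  set h : Fin m → Space N → ℂ := fun j x => recentred A ε u X Ξ j x
    - Complex.exp (Complex.I * (θ j : ℂ)) * (r j (x + y) : ℂ) with hh
  have hhm : ∀ j, MemH1 (h j) := fun j =>
    (memH1_recentred (hu j)).sub ((hr j).phase_translate (θ j) y)
  -- Testing with the bump centred at `εX`: the weighted mass of the recentred function in the ball
  -- of radius `1/ε` is at least `3M/4`.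
  have h1 := (abs_le.1 ((hζ.comp_sub_const (ε • X)).abs_densityDefect_le (A := A) (χ := χ)
    (ε := ε) (M := M) (X := X) (Ξ := Ξ) hu)).1
  simp only [densityDefect, sub_self, hζ0] at h1
  have e1 : ∫ x, ζ (ε • x - ε • X) * density u x
      = ∫ x, ζ (ε • x) * density (recentred A ε u X Ξ) x := by
    rw [← integral_add_right_eq_self _ X]
    refine integral_congr_ae (Eventually.of_forall fun x => ?_)
    simp only [smul_add, add_sub_cancel_right, density, norm_recentred]
  have hmom : Integrable fun x => ‖x + y‖ ^ 2 * ∑ j, r j (x + y) ^ 2 :=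
    hρ.moment.comp_add_right y
  have ih : Integrable fun x => ∑ j, ‖h j x‖ ^ 2 := integrable_density hhm
  -- Chebyshev: on the support of the bump `‖x + y‖ ≥ L`, so the translate has mass at most `J / L²`
  -- there. The rest of the density is paid for by the error `h`, with a factor `2` from squaring
  -- the sum.
  have h2 : ∫ x, ζ (ε • x) * density (recentred A ε u X Ξ) x
      ≤ ∫ x, (2 * (∑ j, ‖h j x‖ ^ 2) + 2 / L ^ 2 * (‖x + y‖ ^ 2 * ∑ j, r j (x + y) ^ 2)) := by
    refine integral_mono_of_nonneg
      (Eventually.of_forall fun x => mul_nonneg (hζn _) (density_nonneg _ x))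
      ((ih.const_mul 2).add (hmom.const_mul _)) (Eventually.of_forall fun x => ?_)
    have hs1 : 0 ≤ ∑ j, ‖h j x‖ ^ 2 := Finset.sum_nonneg fun _ _ => by positivity
    have hs2 : 0 ≤ ∑ j, r j (x + y) ^ 2 := Finset.sum_nonneg fun _ _ => by positivity
    simp only
    by_cases hx : 1 ≤ ‖ε • x‖
    · rw [hζs _ hx, zero_mul]
      positivity
    · have hxε : ‖x‖ < ε⁻¹ := by
        rw [norm_smul, Real.norm_of_nonneg hε.le, not_le] at hx
        rw [← one_div, lt_div_iff₀ hε]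
        linarith
      have hxy : L ≤ ‖x + y‖ := by
        have := norm_sub_le (x + y) x
        rw [add_sub_cancel_left] at this
        linarith
      have hsum : density (recentred A ε u X Ξ) x
          ≤ 2 * (∑ j, ‖h j x‖ ^ 2) + 2 * ∑ j, r j (x + y) ^ 2 := by
        rw [density, Finset.mul_sum, Finset.mul_sum, ← Finset.sum_add_distrib]
        refine Finset.sum_le_sum fun j _ => ?_
        have hn : ‖recentred A ε u X Ξ j x‖ ≤ ‖h j x‖ + |r j (x + y)| := by
          have := norm_add_le (h j x) (Complex.exp (Complex.I * (θ j : ℂ)) * (r j (x + y) : ℂ))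
          rw [hh] at this ⊢
          simp only [sub_add_cancel, norm_mul] at this
          rw [mul_comm Complex.I, Complex.norm_exp_ofReal_mul_I, one_mul, Complex.norm_real,
            Real.norm_eq_abs] at this
          simpa only [mul_comm Complex.I] using this
        rw [← sq_abs (r j (x + y))]
        nlinarith [norm_nonneg (recentred A ε u X Ξ j x), norm_nonneg (h j x),
          abs_nonneg (r j (x + y)), sq_nonneg (‖h j x‖ - |r j (x + y)|)]
      have h3 : 2 * ∑ j, r j (x + y) ^ 2
          ≤ 2 / L ^ 2 * (‖x + y‖ ^ 2 * ∑ j, r j (x + y) ^ 2) := by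
        rw [div_mul_eq_mul_div, le_div_iff₀ (by positivity)]
        have : L ^ 2 ≤ ‖x + y‖ ^ 2 := by gcongr
        nlinarith
      calc ζ (ε • x) * density (recentred A ε u X Ξ) x
          ≤ density (recentred A ε u X Ξ) x := mul_le_of_le_one_left (density_nonneg _ x) (hζ1 _)
        _ ≤ _ := by linarith
  have e2 : ∫ x, ‖x + y‖ ^ 2 * ∑ j, r j (x + y) ^ 2 = J :=
    integral_add_right_eq_self (fun x => ‖x‖ ^ 2 * ∑ j, r j x ^ 2) y
  rw [integral_add (ih.const_mul 2) (hmom.const_mul _), integral_const_mul, integral_const_mul,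
    e2] at h2
  have h4 : ∫ x, ∑ j, ‖h j x‖ ^ 2 ≤ M / 8 := by
    rw [integral_finsetSum _ fun j _ => integrable_normSq (hhm j).1]
    exact (Finset.sum_le_sum fun j _ => integral_normSq_le_h1NormSq (h j)).trans hd
  -- From `3M/4 ≤ 2 · M/8 + 2J/L²`.
  have h5 : M / 4 ≤ J / L ^ 2 := by
    rw [e1] at h1
    have : 2 / L ^ 2 * J = 2 * (J / L ^ 2) := by ring
    linarith
  have h6 : L ^ 2 ≤ 4 * J / M := by
    rw [le_div_iff₀ (by positivity)] at h5
    rw [le_div_iff₀ hM]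
    linarith
  nlinarith [sq_nonneg (L - 1)]

/-! ### The orbit distance -/

lemma orbitDistSq_le (r : Fin m → Space N → ℝ) (U : Fin m → Space N → ℂ) (y : Space N)
    {θ : Fin m → ℝ} (hθ : ∀ j, θ j ∈ Ico 0 (2 * Real.pi)) :
    orbitDistSq r U ≤ ∑ j, h1NormSq fun x =>
      U j x - Complex.exp (Complex.I * (θ j : ℂ)) * (r j (x + y) : ℂ) := by
  refine csInf_le ⟨0, ?_⟩ ⟨y, θ, hθ, rfl⟩
  rintro d ⟨y, θ, -, rfl⟩
  exact Finset.sum_nonneg fun _ _ => h1NormSq_nonneg _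

lemma exists_of_orbitDistSq_lt {r : Fin m → Space N → ℝ} {U : Fin m → Space N → ℂ} {d : ℝ}
    (h : orbitDistSq r U < d) : ∃ (y : Space N) (θ : Fin m → ℝ),
      (∀ j, θ j ∈ Ico 0 (2 * Real.pi)) ∧ ∑ j, h1NormSq (fun x =>
        U j x - Complex.exp (Complex.I * (θ j : ℂ)) * (r j (x + y) : ℂ)) < d := by
  rw [orbitDistSq] at h
  obtain ⟨_, ⟨y, θ, hθ, rfl⟩, hd⟩ := exists_lt_of_csInf_lt
    (by exact ⟨_, 0, fun _ => 0, fun _ => ⟨le_rfl, by positivity⟩, rfl⟩) h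
  exact ⟨y, θ, hθ, hd⟩

lemma h1NormSq_eq_zero {u v : Space N → ℂ} (hu : MemH1 u) (h : u =ᵐ[volume] v) :
    h1NormSq (fun x => u x - v x) = 0 := by
  have hg := hu.hasWeakGrad.sub (hu.hasWeakGrad.congr h)
  rw [hg.h1NormSq_eq]
  have e1 : ∫ x, ‖weakGrad u x - weakGrad u x‖ ^ 2 = 0 := by simp
  have e2 : ∫ x, ‖u x - v x‖ ^ 2 = 0 := by
    refine integral_eq_zero_of_ae ?_
    filter_upwards [h] with x hx
    simp [hx]
  rw [e1, e2, add_zero]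

lemma orbitDistSq_nonpos_of_ae_eq {r : Fin m → Space N → ℝ} {U : Fin m → Space N → ℂ}
    (hU : ∀ j, MemH1 (U j)) (h : ∀ j, U j =ᵐ[volume] cplx r j) : orbitDistSq r U ≤ 0 := by
  refine (orbitDistSq_le r U 0 (θ := fun _ => 0) fun _ => ⟨le_rfl, by positivity⟩).trans
    (le_of_eq (Finset.sum_eq_zero fun j _ => ?_))
  have := h1NormSq_eq_zero (hU j) (h j)
  simpa [cplx] using this

/-- The recentred function stays at bounded distance from `r` itself. -/
lemma sum_h1NormSq_sub_le {r : Fin m → Space N → ℝ} {U : Fin m → Space N → ℂ}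
    (hr : ∀ j, MemH1 (cplx r j)) (hU : ∀ j, MemH1 (U j)) {σ : ℝ} (h : orbitDistSq r U ≤ σ) :
    ∑ j, h1NormSq (fun x => U j x - Complex.exp (Complex.I * ((0 : ℝ) : ℂ)) * (r j (x + 0) : ℂ))
      ≤ 2 * (σ + 1) + 12 * ∑ j, h1NormSq (cplx r j) := by
  obtain ⟨y, θ, -, hd⟩ := exists_of_orbitDistSq_lt (h.trans_lt (lt_add_one σ))
  -- The constant is `12 = 2 (2 + 2 · 2)`: the inequality for the square of a difference is used
  -- twice, and `h1NormSq_phase_translate_le` loses one more factor `2`.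
  have key : ∀ j, h1NormSq (fun x =>
      U j x - Complex.exp (Complex.I * ((0 : ℝ) : ℂ)) * (r j (x + 0) : ℂ))
      ≤ 2 * h1NormSq (fun x => U j x - Complex.exp (Complex.I * (θ j : ℂ)) * (r j (x + y) : ℂ))
        + 12 * h1NormSq (cplx r j) := fun j => by
    have m1 := (hU j).sub ((hr j).phase_translate (θ j) y)
    have m2 := (hr j).sub ((hr j).phase_translate (θ j) y)
    have h1 := h1NormSq_sub_le m1 m2
    have h2 := h1NormSq_sub_le (hr j) ((hr j).phase_translate (θ j) y)
    have h3 := h1NormSq_phase_translate_le (hr j) (θ j) y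
    have e : (fun x => U j x - Complex.exp (Complex.I * ((0 : ℝ) : ℂ)) * (r j (x + 0) : ℂ))
        = fun x => (U j x - Complex.exp (Complex.I * (θ j : ℂ)) * (r j (x + y) : ℂ))
          - (cplx r j x - Complex.exp (Complex.I * (θ j : ℂ)) * (r j (x + y) : ℂ)) := by
      funext x
      simp [cplx]
    rw [e]
    linarith
  refine (Finset.sum_le_sum fun j _ => key j).trans ?_
  rw [Finset.sum_add_distrib, ← Finset.mul_sum, ← Finset.mul_sum]
  linarith

lemma totalMass_cplx_pos {r : Fin m → Space N → ℝ} (hr : ∀ j, MemH1 (cplx r j))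
    (h : ∃ j, ¬ r j =ᵐ[volume] 0) : 0 < totalMass (cplx r) := by
  obtain ⟨j, hj⟩ := h
  have h0 : ∀ j, 0 ≤ mass (cplx r) j := fun j => integral_nonneg fun _ => by positivity
  refine lt_of_lt_of_le (lt_of_le_of_ne (h0 j) fun he => hj ?_)
    (Finset.single_le_sum (fun j _ => h0 j) (Finset.mem_univ j))
  have := (integral_eq_zero_iff_of_nonneg (fun x => by positivity)
    (integrable_normSq (hr j).1)).1 he.symm
  filter_upwards [this] with x hx
  simpa [cplx] using hx

/-! ### The error term -/

/-- Inverse of the recentring: the error in the original frame is a plane wave times a translate of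
the error measured by `orbitDistSq`. A shift `y` there places the profile at `X - y`. -/
lemma error_eq (A : Space N → Space N) (ε : ℝ) (u : Fin m → Space N → ℂ)
    (r : Fin m → Space N → ℝ) (X Ξ y : Space N) (θ : ℝ) (j : Fin m) :
    (fun z => u j z - Complex.exp (Complex.I * ((inner ℝ Ξ z + θ
      + inner ℝ (A (ε • X)) (z - X) : ℝ) : ℂ)) * (r j (z - (X - y)) : ℂ))
    = fun z => planeWave (Ξ + A (ε • X)) (-inner ℝ (A (ε • X)) X) z *
      ((fun x => recentred A ε u X Ξ j x
        - Complex.exp (Complex.I * (θ : ℂ)) * (r j (x + y) : ℂ)) (z + -X)) := by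
  funext z
  simp only [recentred_eq, mul_sub, neg_add_cancel_right, ← mul_assoc]
  congr 2
  · rw [planeWave, planeWave, ← Complex.exp_add, ← mul_add, ← Complex.ofReal_add]
    have : inner ℝ (Ξ + A (ε • X)) z + -inner ℝ (A (ε • X)) X
        + (inner ℝ (-(Ξ + A (ε • X))) (z + -X) + -inner ℝ Ξ X) = 0 := by
      simp only [inner_neg_left, inner_add_left, inner_add_right, inner_neg_right]
      ring
    rw [this]
    simp
  · rw [planeWave, ← Complex.exp_add, ← mul_add, ← Complex.ofReal_add]
    congr 3
    simp only [inner_add_left, inner_sub_right]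
    ring
  · congr 2
    abel

/-- The hypotheses of well-posedness give the conservation laws along a solution. -/
lemma WellPosed.conservation {K : Couplings m} {P : Potentials N} (h : WellPosed K P) {ε : ℝ}
    (hε : 0 < ε) {φ₀ : Fin m → Space N → ℂ} {φ : ℝ → Fin m → Space N → ℂ}
    (hφ : IsSolution K P ε φ₀ φ) {t : ℝ} (ht : 0 ≤ t) :
    (∀ j, mass (φ t) j = mass (φ 0) j) ∧ totalEnergy K P ε (φ t) = totalEnergy K P ε (φ 0) := by
  -- Well-posedness is invoked with datum `φ 0`, known to lie in `H_{A,ε}`; the prescribed datum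
  -- only agrees with it almost everywhere.
  have hφ' : IsSolution K P ε (φ 0) φ :=
    ⟨hφ.mem, hφ.cont, hφ.hasDeriv, hφ.deriv_cont, fun _ => EventuallyEq.rfl⟩
  obtain ⟨-, h2, h3, -⟩ := (h ε hε (φ 0) (hφ.mem 0 le_rfl)).2.2 φ hφ'
  exact ⟨h2 t ht, h3 t ht⟩

/-! ### The main estimate -/

/-- Conservation of the Hamiltonian and boundedness of `V` control `‖ξ‖`, uniformly in both time and
`ε`. -/
lemma norm_momentum_trajectory_le {P : Potentials N} {ε BA BV : ℝ} (hA : C3Bound P.A BA)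
    (hV : C3Bound P.V BV) {x₀ ξ₀ : Space N} {x ξ : ℝ → Space N}
    (h : IsTrajectory P ε x₀ ξ₀ x ξ) {t : ℝ} (ht : 0 ≤ t) :
    ‖ξ t + P.A (ε • x t)‖ ≤ Real.sqrt (‖ξ₀‖ ^ 2 + 4 * BV) + BA := by
  refine (norm_add_le _ _).trans (add_le_add (Real.le_sqrt_of_sq_le ?_) (hA.norm_le _))
  have h1 := h.hamiltonian_eq hV ht
  have h2 := abs_le.1 (hV.norm_le (ε • x t))
  have h3 := abs_le.1 (hV.norm_le (ε • x 0))
  rw [h.ξ_init] at h1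
  linarith

/-- The energy of the recentred solution exceeds the energy of the ground state by at most
`O(Ω + ε^2)`. -/
lemma exists_energy_sub_le {K : Couplings m} {P : Potentials N} {BA BV BΦ : ℝ}
    (hA : C3Bound P.A BA) (hV : C3Bound P.V BV) (hΦ : C3Bound P.Φ BΦ) (hΦ0 : ∀ z, 0 ≤ P.Φ z)
    (hmax : 1 < m → ∀ z, P.Φ z ≤ P.Φ 0) (χ : Space N → ℝ) {r : Fin m → Space N → ℝ}
    (hr : ∀ j, MemH1 (cplx r j)) (hw : ∀ j, EvenWeight fun x => r j x ^ 2)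
    (hwp : WellPosed K P) (x₀ ξ₀ : Space N) :
    ∃ C, 0 ≤ C ∧ ∀ (ε : ℝ) (x ξ : ℝ → Space N) (φ : ℝ → Fin m → Space N → ℂ) (t : ℝ), 0 < ε →
      IsTrajectory P ε x₀ ξ₀ x ξ → IsSolution K P ε (initialDatum P.A ε r (x 0) (ξ 0)) φ → 0 ≤ t →
      totalMass (φ t) = totalMass (cplx r) ∧
      energy K (recentred P.A ε (φ t) (x t) (ξ t)) - energy K (cplx r)
        ≤ C * (omega P.A χ ε (totalMass (cplx r)) (φ t) (x t) (ξ t) + ε ^ 2) := by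
  set R := Real.sqrt (‖ξ₀‖ ^ 2 + 4 * BV) + BA
  obtain ⟨C₁, hC₁⟩ := exists_energy_recentred_le K P hA hV hΦ hΦ0 hmax χ R (totalMass (cplx r))
  obtain ⟨C₂, hC₂⟩ := exists_le_energy_initialDatum K P hA hV hΦ hr hw R
  refine ⟨|C₁| + |C₂|, by positivity, fun ε x ξ φ t hε hx hφ ht => ?_⟩
  have hmem : ∀ s, 0 ≤ s → ∀ j, MemH1 (φ s j) := fun s hs j =>
    (hφ.mem s hs).memH1 hA.continuous hA.norm_le j
  obtain ⟨hmass, hen⟩ := hwp.conservation hε hφ ht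
  have hmass0 : ∀ j, mass (φ t) j = mass (cplx r) j := fun j => by
    rw [hmass, mass, integral_congr_ae (normSq_ae_eq_of_initialDatum hφ.init j),
      integral_sub_right_eq_self (fun x => r j x ^ 2)]
    simp only [mass, norm_cplx_sq]
  have hM : totalMass (φ t) = totalMass (cplx r) := Finset.sum_congr rfl fun j _ => hmass0 j
  refine ⟨hM, ?_⟩
  have h1 := hC₁ ε (φ t) (x t) (ξ t) (hmem t ht) hM (norm_momentum_trajectory_le hA hV hx ht)
  have h2 := hC₂ ε (φ 0) (x 0) (ξ 0) (hmem 0 le_rfl) hφ.init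
    (norm_momentum_trajectory_le hA hV hx le_rfl)
  -- After these substitutions, and with the conserved component masses in `couplingSum`, the main
  -- terms of the bounds at times `t` and `0` are identical; only `C₁ Ω + C₂ ε²` survives.
  rw [hen, hx.hamiltonian_eq hV ht] at h1
  simp only [hmass0] at h1
  have hΩ : 0 ≤ omega P.A χ ε (totalMass (cplx r)) (φ t) (x t) (ξ t) := omega_nonneg
  have e1 := mul_le_mul_of_nonneg_right (le_abs_self C₁) hΩ
  have e2 := mul_le_mul_of_nonneg_right (le_abs_self C₂) (sq_nonneg ε)
  have e3 := mul_nonneg (abs_nonneg C₂) hΩ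
  have e4 := mul_nonneg (abs_nonneg C₁) (sq_nonneg ε)
  linarith

lemma le_of_lt_exitTime {T σ : ℝ} {Ω Γ : ℝ → ℝ} (hT : 0 ≤ T) {t : ℝ} (ht0 : 0 < t)
    (ht : t < exitTime T σ Ω Γ) : Ω t ≤ σ ∧ Γ t ≤ σ := by
  rw [exitTime] at ht
  obtain ⟨t', ⟨-, h⟩, htt'⟩ := exists_lt_of_lt_csSup
    (by exact ⟨0, ⟨le_rfl, hT⟩, fun s hs => absurd (hs.1.trans hs.2) (lt_irrefl _)⟩) ht
  exact h t ⟨ht0, htt'⟩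

/-- Choice of a translation and of phases for which the recentred function is close to the
profile, with a bound on the translation. -/
lemma exists_shift {r : Fin m → Space N → ℝ} (hr : ∀ j, MemH1 (cplx r j))
    (hw : ∀ j, EvenWeight fun x => r j x ^ 2) (A : Space N → Space N) (χ : Space N → ℝ) {M : ℝ}
    (hM : 0 < M) {C σ : ℝ} (hC : 0 ≤ C) (hσ : 0 ≤ σ) :
    ∃ ε₀ > 0, ∃ C' ≥ 0, ∃ Y ≥ 0, ∀ ε ∈ Ioo 0 ε₀, ∀ (u : Fin m → Space N → ℂ) (X Ξ : Space N),
      (∀ j, MemH1 (u j)) → orbitDistSq r (recentred A ε u X Ξ) ≤ σ →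
      orbitDistSq r (recentred A ε u X Ξ) ≤ C * (omega A χ ε M u X Ξ + ε ^ 2) →
      ∃ (y : Space N) (θ : Fin m → ℝ), (∀ j, θ j ∈ Ico 0 (2 * Real.pi)) ∧ ‖y‖ ≤ ε⁻¹ + Y ∧
        ∑ j, h1NormSq (fun x => recentred A ε u X Ξ j x
          - Complex.exp (Complex.I * (θ j : ℂ)) * (r j (x + y) : ℂ))
          ≤ C' * (omega A χ ε M u X Ξ + ε ^ 2) := by
  obtain ⟨ζ, Bζ, hζ, hζ0, hζn, hζ1, hζs⟩ := exists_bump N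
  have hD : 0 < ckConst N * (Bζ + 1) := mul_pos (ckConst_pos N) (by linarith [hζ.nonneg])
  set D := ckConst N * (Bζ + 1) with hDdef
  set J := ∫ x, ‖x‖ ^ 2 * ∑ j, r j x ^ 2 with hJ
  have hJ0 : 0 ≤ J := (EvenWeight.sum hw).moment_nonneg
  set Z := 2 * (σ + 1) + 12 * ∑ j, h1NormSq (cplx r j) with hZ
  have hZ0 : 0 ≤ Z := by
    have : 0 ≤ ∑ j, h1NormSq (cplx r j) := Finset.sum_nonneg fun _ _ => h1NormSq_nonneg _
    positivity
  -- With `Ω` and `ε²` below `η`, the squared distance `(C + 1)(Ω + ε²)` is at most `M/8`; the other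
  -- entry of `δ` gives the defect bound `M/4`. These are the smallness conditions of
  -- `norm_shift_le`.
  set η := M / (16 * (C + 1)) with hη
  have hη0 : 0 < η := by positivity
  set δ := min η (M / (4 * D)) with hδ
  have hδ0 : 0 < δ := lt_min hη0 (by positivity)
  refine ⟨Real.sqrt η, Real.sqrt_pos.2 hη0, C + 1 + Z / δ, by positivity, 1 + 4 * J / M,
    by positivity, fun ε hε u X Ξ hu hΓσ hΓ => ?_⟩
  set Ω := omega A χ ε M u X Ξ with hΩdef
  have hΩ0 : 0 ≤ Ω := omega_nonneg
  have hε2 : ε ^ 2 < η := (Real.lt_sqrt hε.1.le).1 hε.2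
  have hεpos : 0 < ε ^ 2 := pow_pos hε.1 2
  rcases lt_or_ge Ω δ with hΩ | hΩ
  -- The attainment of the infimum is not needed: an excess of `ε²` is affordable.
  · obtain ⟨y, θ, hθ, hd⟩ := exists_of_orbitDistSq_lt (lt_of_le_of_lt hΓ
      (lt_add_of_pos_right _ hεpos))
    have hd1 : C * (Ω + ε ^ 2) + ε ^ 2 ≤ (C + 1) * (Ω + ε ^ 2) := by nlinarith
    have hd2 : (C + 1) * (Ω + ε ^ 2) ≤ M / 8 := by
      have h1 : Ω ≤ η := hΩ.le.trans (min_le_left _ _)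
      calc (C + 1) * (Ω + ε ^ 2) ≤ (C + 1) * (η + η) := by gcongr
        _ = M / 8 := by rw [hη]; field_simp; ring
    have hDΩ : D * Ω ≤ M / 4 := by
      calc D * Ω ≤ D * (M / (4 * D)) := by gcongr; exact hΩ.le.trans (min_le_right _ _)
        _ = M / 4 := by field_simp
    have hy := norm_shift_le hu hr hw hM hζ hζ0 hζn hζ1 hζs hε.1 hDΩ
      (hd.le.trans (hd1.trans hd2))
    refine ⟨y, θ, hθ, by linarith, hd.le.trans (hd1.trans ?_)⟩
    exact mul_le_mul_of_nonneg_right (le_add_of_nonneg_right (by positivity)) (by positivity)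
  -- For `Ω ≥ δ` no closeness is required: the distance to `r` itself is at most `Z ≤ (Z/δ) Ω`, so
  -- the trivial shift and phases do.
  · refine ⟨0, fun _ => 0, fun _ => ⟨le_rfl, by positivity⟩, ?_, ?_⟩
    · have := inv_pos.2 hε.1
      rw [norm_zero]
      positivity
    · refine (sum_h1NormSq_sub_le hr (fun j => memH1_recentred (hu j)) hΓσ).trans ?_
      calc Z = Z / δ * δ := by field_simp
        _ ≤ (C + 1 + Z / δ) * (Ω + ε ^ 2) := by
            gcongr
            · exact le_add_of_nonneg_left (by positivity)
            · linarith

lemma IsTrajectory.locBdd {P : Potentials N} {ε : ℝ} {x₀ ξ₀ : Space N} {x ξ : ℝ → Space N}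
    (h : IsTrajectory P ε x₀ ξ₀ x ξ) : LocBdd x := fun T =>
  (isCompact_Icc (a := (0 : ℝ)) (b := T)).exists_bound_of_continuousOn fun t ht =>
    (h.x_deriv t ht.1).continuousWithinAt.mono Icc_subset_Ici_self

lemma sqrt_mul_add_sq_le {C Ω ε : ℝ} (hC : 0 ≤ C) (hΩ : 0 ≤ Ω) (hε : 0 ≤ ε) :
    Real.sqrt (C * (Ω + ε ^ 2)) ≤ (Real.sqrt C + 1) * Real.sqrt Ω + (Real.sqrt C + 1) * ε := by
  rw [Real.sqrt_mul hC]
  have h : Real.sqrt (Ω + ε ^ 2) ≤ Real.sqrt Ω + ε := by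
    rw [Real.sqrt_le_left (by positivity)]
    nlinarith [Real.sq_sqrt hΩ, mul_nonneg (Real.sqrt_nonneg Ω) hε]
  have h1 := mul_le_mul_of_nonneg_left h (Real.sqrt_nonneg C)
  nlinarith [Real.sqrt_nonneg Ω]

end SolitonDynamics

end

open SolitonDynamics

theorem mainTheorem2 {m N : ℕ} (hm : 1 ≤ m) (hN : 1 ≤ N)
    (K : SolitonDynamics.Couplings m) (hp : 0 < K.p) (hpN : K.p < 2 / (N : ℝ))
    (P : SolitonDynamics.Potentials N) (hP : P.Regular)
    (hΦ : 1 < m → ∀ z, P.Φ z ≤ P.Φ 0)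
    (r : Fin m → SolitonDynamics.Space N → ℝ) (hr : SolitonDynamics.IsGroundState K r)
    (c c' : ℝ) (hadm : SolitonDynamics.Admissible K P r c c')
    (x₀ ξ₀ : SolitonDynamics.Space N)
    (x ξ : ℝ → ℝ → SolitonDynamics.Space N)
    (hx : ∀ ε, 0 < ε → SolitonDynamics.IsTrajectory P ε x₀ ξ₀ (x ε) (ξ ε))
    (φ : ℝ → ℝ → Fin m → SolitonDynamics.Space N → ℂ)
    (hφ : ∀ ε, 0 < ε → SolitonDynamics.IsSolution K P ε
      (SolitonDynamics.initialDatum P.A ε r (x ε 0) (ξ ε 0)) (φ ε))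
    (T₀ σ₀ ρ : ℝ) (hT₀ : 0 < T₀) (hσ₀ : 0 < σ₀) (hσ₀c : σ₀ < c') (hρ : 0 < ρ)
    (χ : SolitonDynamics.Space N → ℝ) (hχ : SolitonDynamics.IsCutoff ρ χ)
    (M : ℝ) (hM : M = SolitonDynamics.totalMass (SolitonDynamics.cplx r))
    (Ω Γ : ℝ → ℝ → ℝ)
    (hΩ : ∀ ε t, Ω ε t =
      SolitonDynamics.omega P.A χ ε M (φ ε t) (x ε t) (ξ ε t))
    (hΓ : ∀ ε t, Γ ε t = SolitonDynamics.orbitDistSq r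
      (SolitonDynamics.recentred P.A ε (φ ε t) (x ε t) (ξ ε t))) :
    ∃ ε₀ > 0, ∃ C > 0,
      ∃ (θ : ℝ → Fin m → ℝ → ℝ) (y : ℝ → ℝ → SolitonDynamics.Space N)
        (ω : ℝ → ℝ → Fin m → SolitonDynamics.Space N → ℂ),
        ∀ ε ∈ Set.Ioo 0 ε₀,
          (∀ j t, 0 ≤ t → θ ε j t ∈ Set.Ico 0 (2 * Real.pi)) ∧
          (∀ j, SolitonDynamics.LocBdd (θ ε j)) ∧
          SolitonDynamics.LocBdd (y ε) ∧
          ∀ t ∈ Set.Ico 0 (SolitonDynamics.exitTime (T₀ / ε) σ₀ (Ω ε) (Γ ε)), ∀ j,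
            (∀ z, φ ε t j z =
              Complex.exp (Complex.I * ((inner ℝ (ξ ε t) z + θ ε j t
                + inner ℝ (P.A (ε • x ε t)) (z - x ε t) : ℝ) : ℂ)) * (r j (z - y ε t) : ℂ)
              + ω ε t j z) ∧
            SolitonDynamics.MemH1 (ω ε t j) ∧
            SolitonDynamics.h1Norm (ω ε t j) ≤ C * Real.sqrt (Ω ε t) + C * ε := by
  have hA := C3Bound.of_ckNorm hP.A_contDiff hP.A_bdd
  have hV := C3Bound.of_ckNorm hP.V_contDiff hP.V_bdd
  have hΦB := C3Bound.of_ckNorm hP.Φ_contDiff hP.Φ_bdd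
  have hrm := hr.stationary.memH1
  have hw := evenWeight_sq hrm hadm.radial hadm.moment
  have hMpos : 0 < M := hM ▸ totalMass_cplx_pos hrm hr.stationary.ne_zero
  obtain ⟨C₁, hC₁, hen⟩ := exists_energy_sub_le hA hV hΦB hP.Φ_nonneg hΦ χ hrm hw
    hadm.wellPosed x₀ ξ₀
  rw [← hM] at hen
  obtain ⟨ε₀, hε₀, C₂, hC₂, Y, hY, hsh⟩ := exists_shift hrm hw P.A χ hMpos
    (mul_nonneg hadm.c_pos.le hC₁) hσ₀.le
  have hmem : ∀ ε, 0 < ε → ∀ t, 0 ≤ t → ∀ j, MemH1 (φ ε t j) := fun ε hε t ht j =>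
    ((hφ ε hε).mem t ht).memH1 hA.continuous hA.norm_le j
  -- Outside the relevant range of `ε` and `t` the shift and phases default to `0`. The bound on the
  -- shift thus holds at all times, also after the exit time, as local boundedness on `[0, ∞)`
  -- demands.
  have hsel : ∀ ε t, ∃ (y : Space N) (θ : Fin m → ℝ),
      (∀ j, θ j ∈ Set.Ico 0 (2 * Real.pi)) ∧ (ε ∈ Set.Ioo 0 ε₀ → ‖y‖ ≤ ε⁻¹ + Y) ∧
      (ε ∈ Set.Ioo 0 ε₀ → t ∈ Set.Ico 0 (exitTime (T₀ / ε) σ₀ (Ω ε) (Γ ε)) →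
        ∑ j, h1NormSq (fun z => recentred P.A ε (φ ε t) (x ε t) (ξ ε t) j z
          - Complex.exp (Complex.I * (θ j : ℂ)) * (r j (z + y) : ℂ))
          ≤ C₂ * (Ω ε t + ε ^ 2)) := by
    intro ε t
    by_cases h : ε ∈ Set.Ioo 0 ε₀ ∧ t ∈ Set.Ico 0 (exitTime (T₀ / ε) σ₀ (Ω ε) (Γ ε))
    · obtain ⟨hε, ht⟩ := h
      have hu := hmem ε hε.1 t ht.1
      have hΓσ : orbitDistSq r (recentred P.A ε (φ ε t) (x ε t) (ξ ε t)) ≤ σ₀ := by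
        -- The exit time constrains only times `s > 0`. At `t = 0` the recentred function is `r`
        -- almost everywhere, and its orbit distance vanishes.
        rcases ht.1.eq_or_lt with h0 | h0
        · subst h0
          exact (orbitDistSq_nonpos_of_ae_eq (fun j => memH1_recentred (hu j))
            (recentred_ae_eq_of_initialDatum (hφ ε hε.1).init)).trans hσ₀.le
        · rw [← hΓ]
          exact (le_of_lt_exitTime (by have := hε.1; positivity) h0 ht.2).2
      obtain ⟨hmass, hE⟩ := hen ε (x ε) (ξ ε) (φ ε) t hε.1 (hx ε hε.1) (hφ ε hε.1) ht.1
      have hconv := hadm.convexity _ (fun j => memH1_recentred (hu j))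
        ((totalMass_recentred P.A ε (φ ε t) (x ε t) (ξ ε t)).trans (hmass.trans hM))
        (hΓσ.trans_lt hσ₀c)
      obtain ⟨y, θ, hθ, hy, hd⟩ := hsh ε hε (φ ε t) (x ε t) (ξ ε t) hu hΓσ
        (hconv.trans (by
          rw [mul_assoc]
          exact mul_le_mul_of_nonneg_left hE hadm.c_pos.le))
      exact ⟨y, θ, hθ, fun _ => hy, fun _ _ => by rw [hΩ]; exact hd⟩
    · refine ⟨0, fun _ => 0, fun _ => ⟨le_rfl, by positivity⟩, fun hε => ?_,
        fun h1 h2 => absurd ⟨h1, h2⟩ h⟩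
      have := inv_pos.2 hε.1
      rw [norm_zero]
      positivity
  choose y θ hθ hy hd using hsel
  set R := Real.sqrt (‖ξ₀‖ ^ 2 + 4 * (((N : ℝ) + 1) ^ 3 * (ckNorm 3 P.V).toReal))
    + ((N : ℝ) + 1) ^ 3 * (ckNorm 3 P.A).toReal with hR
  -- `R` bounds the frequency `ξ + A(εx)`, so `2 + 2R²` is the price of the plane wave in the
  -- squared `H^1` norm.
  set C₃ := (2 + 2 * R ^ 2) * C₂ with hC₃
  have hC₃0 : 0 ≤ C₃ := by positivity
  refine ⟨ε₀, hε₀, Real.sqrt C₃ + 1, by positivity, fun ε j t => θ ε t j,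
    fun ε t => x ε t - y ε t, fun ε t j z => φ ε t j z -
      Complex.exp (Complex.I * ((inner ℝ (ξ ε t) z + θ ε t j
        + inner ℝ (P.A (ε • x ε t)) (z - x ε t) : ℝ) : ℂ)) * (r j (z - (x ε t - y ε t)) : ℂ),
    fun ε hε => ⟨fun j t _ => hθ ε t j, fun j T => ⟨2 * Real.pi, fun t _ => ?_⟩, fun T => ?_,
      fun t ht j => ⟨fun z => by ring, ?_⟩⟩⟩
  · rw [Real.norm_of_nonneg (hθ ε t j).1]
    exact (hθ ε t j).2.le
  · obtain ⟨B, hB⟩ := (hx ε hε.1).locBdd T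
    exact ⟨B + (ε⁻¹ + Y), fun t ht => (norm_sub_le _ _).trans (add_le_add (hB t ht) (hy ε t hε))⟩
  · have hh := (memH1_recentred (A := P.A) (ε := ε) (X := x ε t) (Ξ := ξ ε t)
      (hmem ε hε.1 t ht.1 j)).sub ((hrm j).phase_translate (θ ε t j) (y ε t))
    simp only [error_eq P.A ε (φ ε t) r (x ε t) (ξ ε t) (y ε t) (θ ε t j) j]
    refine ⟨(hh.comp_add (-x ε t)).planeWave_mul _ _, ?_⟩
    have hΩ0 : 0 ≤ Ω ε t := by rw [hΩ]; exact omega_nonneg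
    refine le_trans ?_ (sqrt_mul_add_sq_le hC₃0 hΩ0 hε.1.le)
    refine Real.sqrt_le_sqrt ?_
    refine (h1NormSq_planeWave_mul_le (hh.comp_add (-x ε t)) _ _).trans ?_
    rw [h1NormSq_comp_add hh, hC₃, mul_assoc]
    have hb := norm_momentum_trajectory_le hA hV (hx ε hε.1) ht.1
    rw [← hR] at hb
    have hle := (Finset.single_le_sum (f := fun j => h1NormSq (fun z =>
      recentred P.A ε (φ ε t) (x ε t) (ξ ε t) j z
        - Complex.exp (Complex.I * (θ ε t j : ℂ)) * (r j (z + y ε t) : ℂ)))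
      (fun _ _ => h1NormSq_nonneg _) (Finset.mem_univ j)).trans (hd ε t hε ht)
    have h0 := h1NormSq_nonneg (fun z => recentred P.A ε (φ ε t) (x ε t) (ξ ε t) j z
        - Complex.exp (Complex.I * (θ ε t j : ℂ)) * (r j (z + y ε t) : ℂ))
    gcongr
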